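/- For $\alpha>0$ let $$E(\alpha)=\{x\in\mathbb{R} : |x-r/q|\le |q|^{-(2+\alpha)} \text{ for infinitely many pairs } (q,r)\in\mathbb{Z}\times\mathbb{Z} \text{ with } q\neq 0\}.$$ For a finite Borel measure $\mu$ on $\mathbb{R}$ and $f\in L^1(\mu)$ put $\mathcal{F}(\mu)(\xi)=\int e^{-2\pi i x\xi}\,d\mu(x)$ and $\mathcal{F}(f\mu)(\xi)=\int e^{-2\pi i x\xi}f(x)\,d\mu(x)$. Let $\lambda$ denote Lebesgue measure on $\mathbb{R}$ and $|I|=\lambda(I)$ the length of an interval $I$. Theorem. Let $\alpha>0$ and $-1<\beta<0$. There exists a Borel probability measure $\mu$ on $\mathbb{R}$ such that the following hold. 1. The (closed) support of $\mu$ is contained in $[-1/2,1/2]\cap E(\alpha)$. 2. For every $\epsilon$ with $0<\epsilon<\frac{2+\beta}{2+\alpha}$ there is a constant $C_\epsilon$ such that $\mu(I)\le C_\epsilon\,|I|^{\frac{2+\beta}{2+\alpha}-\epsilon}$ for every interval $I\subseteq\mathbb{R}$. 3. For every $\epsilon>0$ there is a constant $C_\epsilon$ such that $|\mathcal{F}(\mu)(\xi)|\le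 C_\epsilon\,(1+|\xi|)^{-\frac{1}{2+\alpha}+\epsilon}$ for every $\xi\in\mathbb{R}$. 4. There is a sequence $(f_k)_{k\in\mathbb{N}}$ of nonnegative Borel functions on $\mathbb{R}$, each in $L^\infty(\mu)$ and none of them zero $\mu$-almost everywhere, such that for all $q\in[1,\infty]$ and all $p$ with $0<p<\frac{q}{q-1}(1+\alpha-\beta)$, $$\sup_{k}\frac{\|\mathcal{F}(f_k\mu)\|_{L^p(\lambda)}}{\|f_k\|_{L^q(\mu)}}=\infty .$$ Here $\frac{q}{q-1}$ is read as $\infty$ if $q=1$ and as $1$ if $q=\infty$, and a numerator is $\infty$ if $\mathcal{F}(f_k\mu)\notin L^p(\lambda)$. -/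

import Mathlib

open MeasureTheory

/-- The set of `α`-well-approximable real numbers: those `x` with `|x - r/q| ≤ |q|^(-(2+α))` for
infinitely many pairs `(q, r)` of integers, `q ≠ 0`. -/
def alphaWellApproximable (α : ℝ) : Set ℝ :=
  {x : ℝ | {z : ℤ × ℤ | z.1 ≠ 0 ∧
    |x - (z.2 : ℝ) / (z.1 : ℝ)| ≤ |(z.1 : ℝ)| ^ (-(2 + α))}.Infinite}

/-- The Fourier transform `ξ ↦ ∫ exp(-2πixξ) dμ(x)` of a finite measure `μ` on the real line. -/
noncomputable def measureFourier (μ : Measure ℝ) (ξ : ℝ) : ℂ :=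
  ∫ x : ℝ, Complex.exp (-2 * Real.pi * Complex.I * x * ξ) ∂μ

/-- The Fourier transform `ξ ↦ ∫ exp(-2πixξ) f(x) dμ(x)` of `f μ`, for `f` integrable with respect
to `μ`. -/
noncomputable def densityFourier (f : ℝ → ℝ) (μ : Measure ℝ) (ξ : ℝ) : ℂ :=
  ∫ x : ℝ, Complex.exp (-2 * Real.pi * Complex.I * x * ξ) * (f x : ℂ) ∂μ

/-! Write `τ = 2 + α`, `s = (2 + β) / τ` and `γ = 1 + α - β`. The measure is a weighted sum of
blocks, one for each term of a rapidly growing sequence of integers `N`. A block lives near the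
short progression `r / N`, `1 ≤ r ≤ K`, with `K` about `N ^ (1 + β)`, at scale `N ^ (-τ)`.

Before refinement a block is the smooth probability density `progressionDensity`. Its transform is
at most that of a single bump at scale `N ^ (-τ)`, hence `O(N (1 + |ξ|) ^ (-1/τ))`. One bump has
mass `1 / K ≈ N * (N ^ (-τ)) ^ s`, which leads to interval masses `O(N ℓ ^ s)`. Dividing by `N`
makes both bounds uniform in `N`. If `ξ ≤ N ^ τ / 16` lies within `N / (16 K)` above a multiple of
`N`, then `x ξ` is nearly an integer throughout the block and the transform has no cancellation
(`half_mass_le_norm_measureFourier`). These `ξ` fill a set of measure at least a constant times `N ^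
γ`.

To move the block into `E(α)`, its density is multiplied repeatedly by an average over primes `q` in
`(M, 4M]` of bumps around the fractions `r / q`. By Poisson summation each factor perturbs the
transform only through frequencies near nonzero multiples of `q`, and a nonzero integer has few
prime divisors in the block. With the Chebyshev bound for the number of primes, the error is a small
multiple of `decayWeight`. The square of the logarithm in that weight is what leaves a gain `1 / log
M`. Interval masses change by little as well: by equidistribution on long intervals, and by the
separation of the fractions on short ones, where `s < 2 / τ` (that is, `β < 0`) leaves room. A weak
limit of the successive products (`exists_measure_of_smoothDensity`) is carried by points with good
approximations of arbitrarily large denominator, and it still lies near the progression.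

The blocks (`eventually_exists_component`) lie in intervals that shrink to `0`, so the closed
support of the sum gains only the point `0`, which is in `E(α)`. Let `κ k` be the `k`-th weighted
block, of mass at least a constant times `2 ^ (-k) / N k`, and `f k` its density with respect to
`μ`. Since `κ k ≤ μ`, `f k ≤ 1` almost everywhere, so its `L^q` norm is at most the mass to the
power `1/q`. The transform of `f k μ` is at least half the mass on a set of measure about `(N k) ^
γ`. The quotient is thus at least a constant times `2 ^ (-k) * (N k) ^ (γ / p - (1 - 1/q))`. The
exponent is positive exactly in the stated range of `p`, and `N k ≥ 2 ^ (k ^ 2)` beats the weight.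
-/

open Filter

open scoped FourierTransform ContDiff

/-! ### A unit bump and its rescalings -/

/-- A smooth nonnegative function of integral one that vanishes outside `(-1, 1)`. -/
noncomputable def unitBump : ℝ → ℝ :=
  ContDiffBump.normed (⟨1 / 2, 1, by norm_num, by norm_num⟩ : ContDiffBump (0 : ℝ)) volume

theorem unitBump_nonneg (x : ℝ) : 0 ≤ unitBump x := ContDiffBump.nonneg_normed _ x

theorem contDiff_unitBump : ContDiff ℝ ∞ unitBump := by
  unfold unitBump
  exact ContDiffBump.contDiff_normed _

theorem hasCompactSupport_unitBump : HasCompactSupport unitBump := by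
  unfold unitBump
  exact ContDiffBump.hasCompactSupport_normed _

theorem integral_unitBump : ∫ x, unitBump x = 1 := by
  unfold unitBump
  exact ContDiffBump.integral_normed _

theorem unitBump_eq_zero {x : ℝ} (hx : 1 ≤ |x|) : unitBump x = 0 := by
  have h := ContDiffBump.support_normed_eq
    (⟨1 / 2, 1, by norm_num, by norm_num⟩ : ContDiffBump (0 : ℝ)) (μ := volume)
  by_contra h0
  have : x ∈ Function.support unitBump := h0
  unfold unitBump at this
  rw [h] at this
  simp at this
  linarith

theorem exists_unitBump_le : ∃ A : ℝ, 1 ≤ A ∧ ∀ x, unitBump x ≤ A := by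
  obtain ⟨C, hC⟩ := contDiff_unitBump.continuous.bounded_above_of_compact_support
    hasCompactSupport_unitBump
  exact ⟨max 1 C, le_max_left _ _, fun x => (le_abs_self _).trans ((hC x).trans (le_max_right _ _))⟩

/-- The rescaling of `unitBump` to width `ε`, of integral one. -/
noncomputable def scaledBump (ε x : ℝ) : ℝ := ε⁻¹ * unitBump (x / ε)

theorem scaledBump_nonneg {ε : ℝ} (hε : 0 < ε) (x : ℝ) : 0 ≤ scaledBump ε x :=
  mul_nonneg (inv_nonneg.2 hε.le) (unitBump_nonneg _)

theorem contDiff_scaledBump (ε : ℝ) : ContDiff ℝ ∞ (scaledBump ε) := by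
  unfold scaledBump
  exact contDiff_const.mul (contDiff_unitBump.comp (contDiff_id.div_const _))

theorem scaledBump_eq_zero {ε x : ℝ} (hε : 0 < ε) (hx : ε ≤ |x|) : scaledBump ε x = 0 := by
  unfold scaledBump
  rw [unitBump_eq_zero, mul_zero]
  rw [abs_div, abs_of_pos hε, le_div_iff₀ hε]
  linarith

theorem hasCompactSupport_scaledBump {ε : ℝ} (hε : 0 < ε) :
    HasCompactSupport (scaledBump ε) := by
  refine HasCompactSupport.intro (isCompact_Icc (a := -ε) (b := ε)) fun x hx => ?_
  apply scaledBump_eq_zero hε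
  by_contra h
  exact hx (abs_le.1 (not_le.1 h).le)

theorem scaledBump_le {A : ℝ} (hA : ∀ x, unitBump x ≤ A) {ε : ℝ} (hε : 0 < ε) (x : ℝ) :
    scaledBump ε x ≤ A / ε := by
  unfold scaledBump
  rw [div_eq_inv_mul A]
  exact mul_le_mul_of_nonneg_left (hA _) (inv_nonneg.2 hε.le)

/-! ### Fourier transforms of densities -/

theorem norm_exp_neg_two_pi_mul (x ξ : ℝ) :
    ‖Complex.exp (-2 * Real.pi * Complex.I * x * ξ)‖ = 1 := by
  rw [show (-2 * Real.pi * Complex.I * x * ξ : ℂ) = ((-2 * Real.pi * x * ξ : ℝ) : ℂ) * Complex.I by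
    push_cast; ring]
  exact Complex.norm_exp_ofReal_mul_I _

theorem densityFourier_eq_fourier (G : ℝ → ℝ) (ξ : ℝ) :
    densityFourier G volume ξ = 𝓕 (fun x => (G x : ℂ)) ξ := by
  rw [Real.fourier_real_eq_integral_exp_smul]
  unfold densityFourier
  congr 1
  ext x
  rw [smul_eq_mul]
  congr 2
  push_cast
  ring

/-- A smooth compactly supported real function, as a complex Schwartz function. -/
noncomputable def toComplexSchwartz (G : ℝ → ℝ) (hG : ContDiff ℝ ∞ G) (hs : HasCompactSupport G) :
    SchwartzMap ℝ ℂ :=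
  HasCompactSupport.toSchwartzMap (f := fun x => (G x : ℂ))
    (hs.comp_left (g := fun x : ℝ => (x : ℂ)) Complex.ofReal_zero)
    (Complex.ofRealCLM.contDiff.comp hG)

theorem exists_densityFourier_decay {G : ℝ → ℝ} (hG : ContDiff ℝ ∞ G) (hs : HasCompactSupport G)
    (k : ℕ) :
    ∃ C : ℝ, 0 < C ∧ ∀ ξ : ℝ, ‖densityFourier G volume ξ‖ ≤ C / (1 + |ξ|) ^ k := by
  set f := toComplexSchwartz G hG hs
  refine ⟨max 1 (2 ^ k * (Finset.Iic (k, 0)).sup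
    (fun m => SchwartzMap.seminorm ℂ m.1 m.2) (𝓕 f)), lt_of_lt_of_le one_pos (le_max_left _ _),
    fun ξ => ?_⟩
  have h := SchwartzMap.one_add_le_sup_seminorm_apply (𝕜 := ℂ) (m := (k, 0)) (k := k) (n := 0)
    le_rfl le_rfl (𝓕 f) ξ
  rw [norm_iteratedFDeriv_zero, SchwartzMap.fourier_coe] at h
  have h2 : 𝓕 (f : ℝ → ℂ) ξ = densityFourier G volume ξ := by
    rw [densityFourier_eq_fourier]; rfl
  rw [h2, Real.norm_eq_abs] at h
  rw [le_div_iff₀ (by positivity), mul_comm]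
  exact h.trans (le_max_right _ _)

/-- The change of variables `x ↦ q x - c` in the Fourier transform of a rescaled bump. -/
theorem integral_exp_mul_scaledBump {ε q : ℝ} (hε : 0 < ε) (hq : 0 < q) (c ξ : ℝ) :
    ∫ x : ℝ, Complex.exp (-2 * Real.pi * Complex.I * x * ξ) * (scaledBump ε (q * x - c) : ℂ) =
      (q : ℂ)⁻¹ * (Complex.exp (-2 * Real.pi * Complex.I * (c / q : ℝ) * ξ) *
        densityFourier unitBump volume (ε / q * ξ)) := by
  set g : ℝ → ℂ := fun y => Complex.exp (-2 * Real.pi * Complex.I * (c / q : ℝ) * ξ) *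
    (Complex.exp (-2 * Real.pi * Complex.I * y * (ε / q * ξ : ℝ)) * (unitBump y : ℂ)) with hg
  have h1 : ∀ x : ℝ, Complex.exp (-2 * Real.pi * Complex.I * x * ξ) *
      (scaledBump ε (q * x - c) : ℂ) = (ε : ℂ)⁻¹ * g (q / ε * x - c / ε) := by
    intro x
    simp only [hg, scaledBump]
    rw [← mul_assoc (Complex.exp _), ← Complex.exp_add]
    have e1 : (-2 * Real.pi * Complex.I * (c / q : ℝ) * ξ +
        -2 * Real.pi * Complex.I * (q / ε * x - c / ε : ℝ) * (ε / q * ξ : ℝ) : ℂ) =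
        -2 * Real.pi * Complex.I * x * ξ := by
      have : ((c / q : ℝ) * ξ + (q / ε * x - c / ε : ℝ) * (ε / q * ξ : ℝ) : ℝ) = x * ξ := by
        field_simp; ring
      have h2 := congrArg (fun t : ℝ => (-2 * Real.pi * Complex.I * t : ℂ)) this
      push_cast at h2 ⊢
      linear_combination h2
    rw [e1, show (q * x - c) / ε = q / ε * x - c / ε by ring]
    push_cast
    ring
  simp_rw [h1]
  rw [integral_const_mul, Measure.integral_comp_mul_left (fun y => g (y - c / ε)) (q / ε),
    integral_sub_right_eq_self g, hg, integral_const_mul, densityFourier, abs_of_pos (by positivity)]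
  rw [Complex.real_smul]
  have hεC : (ε : ℂ) ≠ 0 := by exact_mod_cast hε.ne'
  push_cast
  field_simp

theorem integral_scaledBump {ε q : ℝ} (hε : 0 < ε) (hq : 0 < q) (c : ℝ) :
    ∫ x : ℝ, scaledBump ε (q * x - c) = q⁻¹ := by
  have h := integral_exp_mul_scaledBump hε hq c 0
  simp only [Complex.ofReal_zero, mul_zero, Complex.exp_zero, one_mul, densityFourier] at h
  rw [integral_complex_ofReal, integral_complex_ofReal, integral_unitBump] at h
  exact_mod_cast h.trans (mul_one _)

theorem densityFourier_unitBump_zero : densityFourier unitBump volume 0 = 1 := by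
  simp only [densityFourier, Complex.ofReal_zero, mul_zero, Complex.exp_zero, one_mul]
  rw [integral_complex_ofReal, integral_unitBump, Complex.ofReal_one]

/-- Poisson summation for rescaled bumps. -/
theorem tsum_scaledBump {ε : ℝ} (hε : 0 < ε) (y : ℝ) :
    ((∑' n : ℤ, scaledBump ε (y + n) : ℝ) : ℂ) = ∑' n : ℤ,
      densityFourier unitBump volume (ε * n) * Complex.exp (2 * Real.pi * Complex.I * n * y) := by
  have h := SchwartzMap.tsum_eq_tsum_fourier (toComplexSchwartz (scaledBump ε)
    (contDiff_scaledBump ε) (hasCompactSupport_scaledBump hε)) y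
  rw [Complex.ofReal_tsum]
  convert! h using 3 with n n
  · rw [SchwartzMap.fourier_coe, fourier_coe_apply]
    simp only [Complex.ofReal_one, div_one]
    congr 1
    have h2 := densityFourier_eq_fourier (scaledBump ε) n
    have h3 := integral_exp_mul_scaledBump hε one_pos 0 n
    simp only [one_mul, sub_zero, Complex.ofReal_one, inv_one, Complex.ofReal_zero,
      mul_zero, zero_mul, Complex.exp_zero, div_one] at h3
    rw [← h3]
    exact h2

/-! ### The decay weight -/

/-- The weight `(1 + |ξ|)^(-1/τ) (1 + log (1 + |ξ|))²`. -/
noncomputable def decayWeight (τ ξ : ℝ) : ℝ :=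
  (1 + |ξ|) ^ (-(1 / τ)) * (1 + Real.log (1 + |ξ|)) ^ 2

theorem log_one_add_abs_nonneg (ξ : ℝ) : 0 ≤ Real.log (1 + |ξ|) :=
  Real.log_nonneg (by linarith [abs_nonneg ξ])

theorem decayWeight_zero (τ : ℝ) : decayWeight τ 0 = 1 := by simp [decayWeight]

theorem decayWeight_pos (τ ξ : ℝ) : 0 < decayWeight τ ξ := by
  have := log_one_add_abs_nonneg ξ
  unfold decayWeight
  positivity

theorem rpow_le_decayWeight (τ ξ : ℝ) : (1 + |ξ|) ^ (-(1 / τ)) ≤ decayWeight τ ξ := by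
  have := log_one_add_abs_nonneg ξ
  unfold decayWeight
  exact le_mul_of_one_le_right (by positivity) (one_le_pow₀ (by linarith))

theorem exists_decayWeight_le (τ : ℝ) {ε : ℝ} (hε : 0 < ε) :
    ∃ C : ℝ, ∀ ξ, decayWeight τ ξ ≤ C * (1 + |ξ|) ^ (-(1 / τ) + ε) := by
  refine ⟨(1 + 2 / ε) ^ 2, fun ξ => ?_⟩
  have h1 : (1 : ℝ) ≤ 1 + |ξ| := by linarith [abs_nonneg ξ]
  have h0 : (0 : ℝ) < 1 + |ξ| := by linarith
  have h2 : 1 + Real.log (1 + |ξ|) ≤ (1 + 2 / ε) * (1 + |ξ|) ^ (ε / 2) := by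
    have := Real.log_le_rpow_div h0.le (half_pos hε)
    have h3 : 1 ≤ (1 + |ξ|) ^ (ε / 2) := Real.one_le_rpow h1 (half_pos hε).le
    have h4 : (1 + |ξ|) ^ (ε / 2) / (ε / 2) = 2 / ε * (1 + |ξ|) ^ (ε / 2) := by
      field_simp
    rw [h4] at this
    linarith
  have h5 := log_one_add_abs_nonneg ξ
  have h6 : (1 + Real.log (1 + |ξ|)) ^ 2 ≤ ((1 + 2 / ε) * (1 + |ξ|) ^ (ε / 2)) ^ 2 :=
    pow_le_pow_left₀ (by linarith) h2 2
  have h7 : ((1 + |ξ|) ^ (ε / 2)) ^ 2 = (1 + |ξ|) ^ ε := by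
    rw [← Real.rpow_natCast, ← Real.rpow_mul h0.le]
    congr 1
    push_cast
    ring
  rw [mul_pow, h7] at h6
  unfold decayWeight
  rw [Real.rpow_add h0]
  calc _ ≤ (1 + |ξ|) ^ (-(1 / τ)) * ((1 + 2 / ε) ^ 2 * (1 + |ξ|) ^ ε) :=
        mul_le_mul_of_nonneg_left h6 (by positivity)
    _ = _ := by ring

/-- The weight varies slowly, in the manner of Peetre's inequality. -/
theorem decayWeight_le_mul {τ : ℝ} (hτ : 1 ≤ τ) (η ξ : ℝ) :
    decayWeight τ η ≤ decayWeight τ ξ * (1 + |ξ - η|) ^ 3 := by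
  have hη := abs_nonneg η
  have hξ := abs_nonneg ξ
  have ht := abs_nonneg (ξ - η)
  have tri1 : |ξ| ≤ |η| + |ξ - η| := by
    simpa using abs_add_le η (ξ - η)
  have tri2 : |η| ≤ |ξ| + |ξ - η| := by
    have := abs_add_le ξ (η - ξ)
    rw [abs_sub_comm η ξ] at this
    simpa using this
  have hτ0 : 0 < τ := by linarith
  have h1τ : 1 / τ ≤ 1 := by rw [div_le_one hτ0]; exact hτ
  have h1 : (1 + |η|) ^ (-(1 / τ)) ≤ (1 + |ξ|) ^ (-(1 / τ)) * (1 + |ξ - η|) := by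
    have e1 : (1 + |ξ|) ^ (1 / τ) ≤ (1 + |η|) ^ (1 / τ) * (1 + |ξ - η|) := by
      calc (1 + |ξ|) ^ (1 / τ) ≤ ((1 + |η|) * (1 + |ξ - η|)) ^ (1 / τ) :=
            Real.rpow_le_rpow (by linarith) (by nlinarith) (by positivity)
        _ = (1 + |η|) ^ (1 / τ) * (1 + |ξ - η|) ^ (1 / τ) :=
            Real.mul_rpow (by linarith) (by linarith)
        _ ≤ (1 + |η|) ^ (1 / τ) * (1 + |ξ - η|) := by
            refine mul_le_mul_of_nonneg_left ?_ (by positivity)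
            calc _ ≤ (1 + |ξ - η|) ^ (1 : ℝ) :=
                  Real.rpow_le_rpow_of_exponent_le (by linarith) h1τ
              _ = _ := Real.rpow_one _
    have p1 : 0 < (1 + |η|) ^ (1 / τ) := by positivity
    have p2 : 0 < (1 + |ξ|) ^ (1 / τ) := by positivity
    rw [Real.rpow_neg (by linarith), Real.rpow_neg (by linarith), inv_mul_eq_div,
      inv_eq_one_div, div_le_div_iff₀ p1 p2]
    linarith
  have h2 : 1 + Real.log (1 + |η|) ≤ (1 + Real.log (1 + |ξ|)) * (1 + |ξ - η|) := by
    have e1 : Real.log (1 + |η|) ≤ Real.log (1 + |ξ|) + Real.log (1 + |ξ - η|) := by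
      rw [← Real.log_mul (by positivity) (by positivity)]
      exact Real.log_le_log (by positivity) (by nlinarith)
    have e2 : Real.log (1 + |ξ - η|) ≤ |ξ - η| := by
      have := Real.log_le_sub_one_of_pos (show 0 < 1 + |ξ - η| by positivity)
      linarith
    nlinarith [log_one_add_abs_nonneg ξ]
  have h3 := log_one_add_abs_nonneg η
  have h4 := log_one_add_abs_nonneg ξ
  unfold decayWeight
  calc _ ≤ ((1 + |ξ|) ^ (-(1 / τ)) * (1 + |ξ - η|)) *
        ((1 + Real.log (1 + |ξ|)) * (1 + |ξ - η|)) ^ 2 :=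
        mul_le_mul h1 (pow_le_pow_left₀ (by linarith) h2 2) (by positivity) (by positivity)
    _ = _ := by ring

/-- Shifting the summation index by `⌊ξ⌋` reduces to `ξ` in `[0, 1)`, which makes the bound uniform
in `ξ`. -/
theorem exists_tsum_inv_sq_le : ∃ C : ℝ, 0 < C ∧ ∀ ξ : ℝ,
    Summable (fun m : ℤ => ((1 + |ξ - m|) ^ 2)⁻¹) ∧ ∑' m : ℤ, ((1 + |ξ - m|) ^ 2)⁻¹ ≤ C := by
  have hS : Summable (fun m : ℤ => ((1 + |(m : ℝ)|) ^ 2)⁻¹) := by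
    have h1 : Summable (fun m : ℤ => |(m : ℝ)| ^ (-2 : ℝ)) := Real.summable_abs_int_rpow one_lt_two
    have h2 : Summable (fun m : ℤ => |(m : ℝ)| ^ (-2 : ℝ) + if m = 0 then 1 else 0) :=
      h1.add (summable_of_ne_finset_zero (s := {0}) (by intro b hb; simp at hb; simp [hb]))
    refine Summable.of_nonneg_of_le (fun m => by positivity) (fun m => ?_) h2
    by_cases hm : m = 0
    · subst hm
      simp
    · have : 0 < |(m : ℝ)| := by positivity
      simp only [hm, if_false, add_zero]
      rw [Real.rpow_neg this.le]
      refine inv_anti₀ (by positivity) ?_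
      rw [Real.rpow_two]
      nlinarith
  refine ⟨4 * ∑' m : ℤ, ((1 + |(m : ℝ)|) ^ 2)⁻¹ + 1, ?_, fun ξ => ?_⟩
  · have : 0 ≤ ∑' m : ℤ, ((1 + |(m : ℝ)|) ^ 2)⁻¹ := tsum_nonneg fun m => by positivity
    linarith
  have hle : ∀ m : ℤ, ((1 + |ξ - ((m + ⌊ξ⌋ : ℤ) : ℝ)|) ^ 2)⁻¹ ≤ 4 * ((1 + |(m : ℝ)|) ^ 2)⁻¹ := by
    intro m
    have h1 : |(m : ℝ)| ≤ 1 + |ξ - ((m + ⌊ξ⌋ : ℤ) : ℝ)| := by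
      have h2 := Int.floor_le ξ
      have h3 := Int.lt_floor_add_one ξ
      push_cast
      rcases abs_cases (m : ℝ) with h | h <;>
      rcases abs_cases (ξ - (m + ⌊ξ⌋)) with h' | h' <;> linarith
    rw [show (4 : ℝ) * ((1 + |(m : ℝ)|) ^ 2)⁻¹ = (((1 + |(m : ℝ)|) / 2) ^ 2)⁻¹ by
      field_simp; norm_num]
    refine inv_anti₀ (by positivity) (pow_le_pow_left₀ (by positivity) ?_ 2)
    linarith [abs_nonneg (ξ - ((m + ⌊ξ⌋ : ℤ) : ℝ))]
  have hs' : Summable (fun m : ℤ => ((1 + |ξ - ((m + ⌊ξ⌋ : ℤ) : ℝ)|) ^ 2)⁻¹) :=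
    Summable.of_nonneg_of_le (fun m => by positivity) hle (hS.mul_left 4)
  refine ⟨(Equiv.addRight ⌊ξ⌋).summable_iff.1 hs', ?_⟩
  rw [← (Equiv.addRight ⌊ξ⌋).tsum_eq]
  calc _ ≤ ∑' m : ℤ, 4 * ((1 + |(m : ℝ)|) ^ 2)⁻¹ := hs'.tsum_le_tsum hle (hS.mul_left 4)
    _ = 4 * ∑' m : ℤ, ((1 + |(m : ℝ)|) ^ 2)⁻¹ := tsum_mul_left
    _ ≤ _ := by linarith

/-! ### Primes in dyadic blocks -/

/-- The primes in `(M, 4 M]`. -/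
def primeBlock (M : ℕ) : Finset ℕ := (Finset.Ioc M (4 * M)).filter Nat.Prime

theorem mem_primeBlock {M q : ℕ} : q ∈ primeBlock M ↔ (M < q ∧ q ≤ 4 * M) ∧ q.Prime := by
  simp [primeBlock]

/-- Elementary Chebyshev bounds for `θ(4M) - θ(M)`. The factor 4 is needed because the lower bound
has constant `log 2` and the upper one `log 4`: the main term left is `4 M log 2 - 2 M log 2`. -/
theorem eventually_card_primeBlock :
    ∀ᶠ M : ℕ in atTop, (M : ℝ) / 2 ≤ (primeBlock M).card * Real.log M := by
  have h1 : ∀ᶠ x : ℝ in atTop, Real.log x ≤ (1 / 100) * x ^ (1 / 2 : ℝ) := by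
    have := (isLittleO_log_rpow_atTop (show (0 : ℝ) < 1 / 2 by norm_num)).bound
      (show (0 : ℝ) < 1 / 100 by norm_num)
    filter_upwards [this, eventually_ge_atTop 1] with x hx hx1
    rw [Real.norm_of_nonneg (Real.log_nonneg hx1), Real.norm_of_nonneg (by positivity)] at hx
    exact hx
  have h2 : Tendsto (fun M : ℕ => 4 * (M : ℝ)) atTop atTop :=
    tendsto_natCast_atTop_atTop.const_mul_atTop (by norm_num)
  filter_upwards [h2.eventually h1, eventually_ge_atTop 4] with M hM hM4
  have hMr : (4 : ℝ) ≤ M := by exact_mod_cast hM4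
  have hθ := Chebyshev.theta_ge (4 * M)
  have hθ' := Chebyshev.theta_le_log4_mul_x (x := M) (by positivity)
  have hlog4 : Real.log 4 = 2 * Real.log 2 := by
    rw [show (4 : ℝ) = 2 ^ 2 by norm_num, Real.log_pow]; norm_num
  have hl2 := Real.log_two_gt_d9
  have hdiff : Chebyshev.theta ((4 * M : ℕ) : ℝ) - Chebyshev.theta M ≤
      (primeBlock M).card * Real.log (4 * M) := by
    have e1 : Chebyshev.theta ((4 * M : ℕ) : ℝ) - Chebyshev.theta M =
        ∑ p ∈ primeBlock M, Real.log p := by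
      rw [Chebyshev.theta, Chebyshev.theta, Nat.floor_natCast, Nat.floor_natCast, sub_eq_iff_eq_add,
        ← Finset.sum_union]
      · congr 1
        ext p
        simp only [Finset.mem_filter, Finset.mem_Ioc, Finset.mem_union, mem_primeBlock]
        constructor
        · rintro ⟨⟨h1, h2⟩, h3⟩
          by_cases h : M < p
          · exact Or.inl ⟨⟨h, h2⟩, h3⟩
          · exact Or.inr ⟨⟨h1, not_lt.1 h⟩, h3⟩
        · rintro (⟨⟨h1, h2⟩, h3⟩ | ⟨⟨h1, h2⟩, h3⟩)
          · exact ⟨⟨h3.pos, h2⟩, h3⟩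
          · exact ⟨⟨h1, by omega⟩, h3⟩
      · rw [Finset.disjoint_left]
        intro p hp hp'
        rw [mem_primeBlock] at hp
        simp only [Finset.mem_filter, Finset.mem_Ioc] at hp'
        omega
    rw [e1, ← nsmul_eq_mul]
    refine Finset.sum_le_card_nsmul _ _ _ fun p hp => ?_
    rw [mem_primeBlock] at hp
    refine Real.log_le_log (by exact_mod_cast hp.2.pos) ?_
    exact_mod_cast hp.1.2
  have hsq : (4 * (M : ℝ)) ^ (1 / 2 : ℝ) = √(4 * M) := (Real.sqrt_eq_rpow _).symm
  rw [hsq] at hM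
  have hs0 : 0 ≤ √(4 * (M : ℝ)) := Real.sqrt_nonneg _
  have hs1 : √(4 * (M : ℝ)) * √(4 * (M : ℝ)) = 4 * M := Real.mul_self_sqrt (by positivity)
  have hs2 : 1 ≤ √(4 * (M : ℝ)) := by rw [Real.one_le_sqrt]; linarith
  have hlg : Real.log (4 * M + 1) ≤ 2 * Real.log (4 * M) := by
    have : Real.log (4 * M + 1) ≤ Real.log ((4 * M) ^ 2) :=
      Real.log_le_log (by positivity) (by nlinarith)
    rw [Real.log_pow] at this
    exact_mod_cast this
  have hl4 : Real.log (4 * M) ≤ 2 * Real.log M := by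
    have : Real.log (4 * M) ≤ Real.log ((M : ℝ) ^ 2) :=
      Real.log_le_log (by positivity) (by nlinarith)
    rw [Real.log_pow] at this
    exact_mod_cast this
  push_cast at hθ hdiff
  have hc : ((primeBlock M).card : ℝ) * Real.log (4 * M) ≤
      (primeBlock M).card * (2 * Real.log M) := mul_le_mul_of_nonneg_left hl4 (by positivity)
  rw [hlog4] at hθ'
  have e3 : √(4 * (M : ℝ)) * Real.log (4 * M) ≤ 4 * M / 100 := by
    calc _ ≤ √(4 * (M : ℝ)) * (1 / 100 * √(4 * M)) := mul_le_mul_of_nonneg_left hM hs0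
      _ = _ := by linarith
  have e4 : Real.log (4 * M) ≤ 4 * M / 100 := by nlinarith
  nlinarith

/-- A nonzero integer has few divisors in a block of primes. -/
theorem card_primeBlock_dvd_mul_log_le (M : ℕ) {m : ℤ} (hm : m ≠ 0) :
    (((primeBlock M).filter fun q : ℕ => (q : ℤ) ∣ m).card : ℝ) * Real.log M ≤ Real.log |(m : ℝ)| := by
  set S := (primeBlock M).filter fun q : ℕ => (q : ℤ) ∣ m
  rcases Nat.eq_zero_or_pos M with h0 | hM
  · subst h0
    simp only [CharP.cast_eq_zero, Real.log_zero, mul_zero]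
    apply Real.log_nonneg
    exact_mod_cast Int.one_le_abs hm
  have hdvd : ∏ q ∈ S, q ∣ m.natAbs := by
    apply Finset.prod_primes_dvd
    · intro q hq
      exact (mem_primeBlock.1 (Finset.mem_filter.1 hq).1).2.prime
    · intro q hq
      exact Int.natCast_dvd.1 (Finset.mem_filter.1 hq).2
  have hle : M ^ S.card ≤ m.natAbs := by
    refine le_trans ?_ (Nat.le_of_dvd (Int.natAbs_pos.2 hm) hdvd)
    apply Finset.pow_card_le_prod
    intro q hq
    exact (mem_primeBlock.1 (Finset.mem_filter.1 hq).1).1.1.le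
  have hle' : (M : ℝ) ^ S.card ≤ |(m : ℝ)| := by
    rw [← Int.cast_abs, Int.abs_eq_natAbs]
    exact_mod_cast hle
  have := Real.log_le_log (by positivity) hle'
  rwa [Real.log_pow] at this

/-- If some prime of the block divides `m`, then `log |m| ≥ log M`, so the bound `log |m| / log M`
may be squared. The extra `log M` in the denominator compensates the density of primes and still
leaves decay in `M`. -/
theorem card_primeBlock_dvd_le {M : ℕ} (hM : 2 ≤ M) {m : ℤ} (hm : m ≠ 0) :
    (((primeBlock M).filter fun q : ℕ => (q : ℤ) ∣ m).card : ℝ) ≤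
      (1 + Real.log (1 + |(m : ℝ)|)) ^ 2 / (Real.log M) ^ 2 := by
  have hlog : 0 < Real.log M := Real.log_pos (by exact_mod_cast hM)
  have h := card_primeBlock_dvd_mul_log_le M hm
  set S := (primeBlock M).filter fun q : ℕ => (q : ℤ) ∣ m with hS
  have hm1 : 1 ≤ |(m : ℝ)| := by exact_mod_cast Int.one_le_abs hm
  have h2 : Real.log |(m : ℝ)| ≤ Real.log (1 + |(m : ℝ)|) :=
    Real.log_le_log (by linarith) (by linarith)
  have h0 := Real.log_nonneg hm1
  rw [le_div_iff₀ (by positivity)]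
  rcases Nat.eq_zero_or_pos S.card with hc | hc
  · rw [hc]
    simp only [CharP.cast_eq_zero, zero_mul]
    positivity
  · have hc1 : (1 : ℝ) ≤ S.card := by exact_mod_cast hc
    have h3 : Real.log M ≤ Real.log |(m : ℝ)| := by nlinarith
    nlinarith

/-! ### Multiplying a density by an average of bumps at rationals: Fourier side -/

/-- Smooth nonnegative functions supported in a compact subset of `(0, 1)`. -/
structure IsSmoothDensity (G : ℝ → ℝ) : Prop where
  contDiff : ContDiff ℝ ∞ G
  nonneg : ∀ x, 0 ≤ G x
  tsupport_subset : tsupport G ⊆ Set.Ioo 0 1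

namespace IsSmoothDensity

variable {G : ℝ → ℝ}

theorem continuous (hG : IsSmoothDensity G) : Continuous G := hG.contDiff.continuous

theorem hasCompactSupport (hG : IsSmoothDensity G) : HasCompactSupport G :=
  (isCompact_Icc (a := (0 : ℝ)) (b := 1)).of_isClosed_subset (isClosed_tsupport G)
    (hG.tsupport_subset.trans Set.Ioo_subset_Icc_self)

theorem integrable (hG : IsSmoothDensity G) : Integrable G :=
  hG.continuous.integrable_of_hasCompactSupport hG.hasCompactSupport

/-- The margin lets the finite row of bumps stand for the full periodic sum wherever the density is
nonzero. -/
theorem exists_margin (hG : IsSmoothDensity G) :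
    ∃ a : ℝ, 0 < a ∧ ∀ x, G x ≠ 0 → a ≤ x ∧ x ≤ 1 - a := by
  rcases (tsupport G).eq_empty_or_nonempty with h | h
  · refine ⟨1, one_pos, fun x hx => ?_⟩
    have := subset_tsupport G (Function.mem_support.2 hx)
    rw [h] at this
    exact this.elim
  obtain ⟨x₀, hx₀, hmin⟩ := hG.hasCompactSupport.isCompact.exists_isMinOn h continuousOn_id
  obtain ⟨x₁, hx₁, hmax⟩ := hG.hasCompactSupport.isCompact.exists_isMaxOn h continuousOn_id
  have h0 := hG.tsupport_subset hx₀
  have h1 := hG.tsupport_subset hx₁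
  refine ⟨min x₀ (1 - x₁), lt_min h0.1 (by linarith [h1.2]), fun x hx => ?_⟩
  have hx' := subset_tsupport G (Function.mem_support.2 hx)
  have e0 : x₀ ≤ x := hmin hx'
  have e1 : x ≤ x₁ := hmax hx'
  exact ⟨(min_le_left _ _).trans e0, by linarith [min_le_right x₀ (1 - x₁)]⟩

theorem exists_le (hG : IsSmoothDensity G) : ∃ B : ℝ, 1 ≤ B ∧ ∀ x, G x ≤ B := by
  obtain ⟨C, hC⟩ := hG.continuous.bounded_above_of_compact_support hG.hasCompactSupport
  exact ⟨max 1 C, le_max_left _ _, fun x => (le_abs_self _).trans ((hC x).trans (le_max_right _ _))⟩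

theorem mul (hG : IsSmoothDensity G) {F : ℝ → ℝ} (hF : ContDiff ℝ ∞ F) (hF0 : ∀ x, 0 ≤ F x) :
    IsSmoothDensity (fun x => G x * F x) where
  contDiff := hG.contDiff.mul hF
  nonneg x := mul_nonneg (hG.nonneg x) (hF0 x)
  tsupport_subset := (tsupport_mul_subset_left (f := G) (g := F)).trans hG.tsupport_subset

end IsSmoothDensity

/-- The sum of bumps of width `ε / q` at the fractions `r / q`, `0 < r < q`. -/
noncomputable def bumpRow (ε : ℝ) (q : ℕ) (x : ℝ) : ℝ :=
  ∑ r ∈ Finset.Ico 1 q, scaledBump ε (q * x - r)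

/-- The width parameter of the bumps with denominators in `(M, 4 M]`. -/
noncomputable def bumpWidth (τ : ℝ) (M : ℕ) : ℝ := (4 * M : ℝ) ^ (1 - τ)

/-- The average of `bumpRow` over the primes in `(M, 4 M]`. -/
noncomputable def bumpAverage (τ : ℝ) (M : ℕ) (x : ℝ) : ℝ :=
  ((primeBlock M).card : ℝ)⁻¹ * ∑ q ∈ primeBlock M, bumpRow (bumpWidth τ M) q x

theorem bumpWidth_pos (τ : ℝ) {M : ℕ} (hM : 0 < M) : 0 < bumpWidth τ M := by
  unfold bumpWidth
  positivity

theorem bumpWidth_le_one {τ : ℝ} (hτ : 1 ≤ τ) {M : ℕ} (hM : 0 < M) : bumpWidth τ M ≤ 1 := by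
  have : (1 : ℝ) ≤ M := by exact_mod_cast hM
  exact Real.rpow_le_one_of_one_le_of_nonpos (by linarith) (by linarith)

theorem bumpRow_nonneg {ε : ℝ} (hε : 0 < ε) (q : ℕ) (x : ℝ) : 0 ≤ bumpRow ε q x :=
  Finset.sum_nonneg fun _ _ => scaledBump_nonneg hε _

theorem contDiff_bumpRow (ε : ℝ) (q : ℕ) : ContDiff ℝ ∞ (bumpRow ε q) := by
  unfold bumpRow
  refine ContDiff.sum fun r _ => ?_
  exact (contDiff_scaledBump ε).comp ((contDiff_const.mul contDiff_id).sub contDiff_const)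

theorem bumpAverage_nonneg (τ : ℝ) {M : ℕ} (hM : 0 < M) (x : ℝ) : 0 ≤ bumpAverage τ M x :=
  mul_nonneg (by positivity) (Finset.sum_nonneg fun _ _ => bumpRow_nonneg (bumpWidth_pos τ hM) _ _)

theorem contDiff_bumpAverage (τ : ℝ) (M : ℕ) : ContDiff ℝ ∞ (bumpAverage τ M) := by
  unfold bumpAverage
  exact contDiff_const.mul (ContDiff.sum fun q _ => contDiff_bumpRow _ _)

/-- For `x` in `[a, 1 - a]`, the bumps centred at `r ≤ 0` or `r ≥ q` are at distance at least `q a ≥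
ε` from `q x` and contribute nothing. -/
theorem bumpRow_eq_tsum {ε a x : ℝ} (hε : 0 < ε) {q : ℕ} (hq : ε ≤ q * a)
    (hx : a ≤ x) (hx' : x ≤ 1 - a) : bumpRow ε q x = ∑' n : ℤ, scaledBump ε (q * x + n) := by
  rw [tsum_eq_sum (s := (Finset.Ico 1 q).image fun r : ℕ => -(r : ℤ))]
  · rw [Finset.sum_image (fun r _ r' _ h => by simpa using h)]
    unfold bumpRow
    refine Finset.sum_congr rfl fun r _ => ?_
    push_cast
    rw [sub_eq_add_neg]
  · intro n hn
    have hq0 : (0 : ℝ) ≤ q := by positivity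
    apply scaledBump_eq_zero hε
    by_cases h0 : 0 ≤ n
    · have : (0 : ℝ) ≤ n := by exact_mod_cast h0
      rw [abs_of_nonneg (by nlinarith)]
      nlinarith
    · have h1 : (q : ℤ) ≤ -n := by
        by_contra h
        apply hn
        rw [Finset.mem_image]
        exact ⟨(-n).toNat, by rw [Finset.mem_Ico]; omega, by omega⟩
      have h2 : (q : ℝ) ≤ -n := by exact_mod_cast h1
      rw [abs_of_nonpos (by nlinarith)]
      nlinarith

theorem summable_densityFourier_unitBump {ε : ℝ} (hε : 0 < ε) :
    Summable fun n : ℤ => ‖densityFourier unitBump volume (ε * n)‖ := by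
  obtain ⟨C, hC, h⟩ := exists_densityFourier_decay contDiff_unitBump hasCompactSupport_unitBump 2
  obtain ⟨_, -, hS⟩ := exists_tsum_inv_sq_le
  have hS0 := (hS 0).1
  set m := min 1 ε
  have hm : 0 < m := lt_min one_pos hε
  refine Summable.of_nonneg_of_le (fun _ => norm_nonneg _) (fun n => ?_) (hS0.mul_left (C / m ^ 2))
  refine (h _).trans ?_
  rw [zero_sub, abs_neg, ← div_eq_mul_inv, div_div, ← mul_pow]
  refine div_le_div_of_nonneg_left hC.le (by positivity) (pow_le_pow_left₀ (by positivity) ?_ 2)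
  rw [abs_mul, abs_of_pos hε]
  have h1 : m ≤ 1 := min_le_left _ _
  have h2 : m ≤ ε := min_le_right _ _
  nlinarith [abs_nonneg (n : ℝ)]

/-- On the support of `G` the row is `q`-fold periodic, so Poisson summation expands it in the
frequencies `n q`; each of them translates the transform of `G`. -/
theorem hasSum_densityFourier_mul_bumpRow {G : ℝ → ℝ} (hG : IsSmoothDensity G) {ε a : ℝ}
    (ha : ∀ x, G x ≠ 0 → a ≤ x ∧ x ≤ 1 - a) (hε : 0 < ε) {q : ℕ} (hq : ε ≤ q * a) (ξ : ℝ) :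
    HasSum (fun n : ℤ => densityFourier unitBump volume (ε * n) *
      densityFourier G volume (ξ - n * q))
      (densityFourier (fun x => G x * bumpRow ε q x) volume ξ) := by
  set F : ℤ → ℝ → ℂ := fun n x => densityFourier unitBump volume (ε * n) *
    (Complex.exp (-2 * Real.pi * Complex.I * x * (ξ - n * q : ℝ)) * (G x : ℂ)) with hF
  have hint : ∀ t : ℝ, Integrable
      (fun x : ℝ => Complex.exp (-2 * Real.pi * Complex.I * x * t) * (G x : ℂ)) := by
    intro t
    refine hG.integrable.ofReal.bdd_mul (c := 1) (by fun_prop) ?_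
    exact Filter.Eventually.of_forall fun x => (norm_exp_neg_two_pi_mul x t).le
  have h1 : ∀ n, Integrable (F n) := fun n => (hint _).const_mul _
  have h2 : Summable fun n => ∫ x, ‖F n x‖ := by
    have : (fun n => ∫ x, ‖F n x‖) = fun n : ℤ =>
        ‖densityFourier unitBump volume (ε * n)‖ * ∫ x, G x := by
      ext n
      rw [← integral_const_mul]
      congr 1
      ext x
      rw [hF, norm_mul, norm_mul, norm_exp_neg_two_pi_mul, one_mul, Complex.norm_real,
        Real.norm_of_nonneg (hG.nonneg x)]
    rw [this]
    exact (summable_densityFourier_unitBump hε).mul_right _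
  have h3 := hasSum_integral_of_summable_integral_norm h1 h2
  convert! h3 using 1
  · ext n
    rw [hF, integral_const_mul]
    rfl
  · unfold densityFourier
    congr 1
    ext x
    by_cases hx : G x = 0
    · simp [hF, hx]
    have hP := tsum_scaledBump hε (q * x)
    rw [← bumpRow_eq_tsum hε hq (ha x hx).1 (ha x hx).2] at hP
    rw [Complex.ofReal_mul, hP, ← mul_assoc, ← tsum_mul_left]
    congr 1
    ext n
    simp only [hF]
    have : Complex.exp (-2 * Real.pi * Complex.I * x * (ξ - n * q : ℝ)) =
        Complex.exp (-2 * Real.pi * Complex.I * x * ξ) *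
        Complex.exp (2 * Real.pi * Complex.I * n * (q * x : ℝ)) := by
      rw [← Complex.exp_add]
      congr 1
      push_cast
      ring
    rw [this]
    unfold densityFourier
    ring

/-- The terms that bound the Fourier coefficients of bumps, indexed by frequencies. -/
noncomputable def frequencyTerm (τ ξ : ℝ) (m : ℤ) : ℝ :=
  if m = 0 then 0 else (1 + |(m : ℝ)|) ^ (-(1 / τ)) / (1 + |ξ - m|) ^ 5

theorem frequencyTerm_nonneg (τ ξ : ℝ) (m : ℤ) : 0 ≤ frequencyTerm τ ξ m := by
  unfold frequencyTerm
  split_ifs <;> positivity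

theorem summable_frequencyTerm {τ : ℝ} (hτ : 0 < τ) (ξ : ℝ) : Summable (frequencyTerm τ ξ) := by
  obtain ⟨_, -, hS⟩ := exists_tsum_inv_sq_le
  refine Summable.of_nonneg_of_le (frequencyTerm_nonneg τ ξ) (fun m => ?_) (hS ξ).1
  unfold frequencyTerm
  split_ifs
  · positivity
  · have h1 : (1 : ℝ) ≤ 1 + |ξ - m| := by linarith [abs_nonneg (ξ - m)]
    rw [← one_div]
    refine div_le_div₀ zero_le_one ?_ (by positivity) (pow_le_pow_right₀ h1 (by norm_num))
    exact Real.rpow_le_one_of_one_le_of_nonpos (by linarith [abs_nonneg (m : ℝ)])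
      (by rw [neg_nonpos]; positivity)

/-- The term `n = 0` of the expansion is the transform of `G` itself. The others sit at the nonzero
multiples `m = n q`, where the decay of the bump at scale `ε` turns into `(1 + |m|) ^ (-1/τ)` at the
cost of a factor `8 M`. -/
theorem norm_densityFourier_mul_bumpRow_sub_le {G : ℝ → ℝ} (hG : IsSmoothDensity G) {τ a : ℝ}
    (hτ : 1 ≤ τ) (ha : ∀ x, G x ≠ 0 → a ≤ x ∧ x ≤ 1 - a) {M : ℕ} (hM : 0 < M) {q : ℕ}
    (hq0 : 0 < q) (hq : q ≤ 4 * M)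
    (hqa : bumpWidth τ M ≤ q * a) {A B : ℝ} (hA0 : 0 < A)
    (hA : ∀ u, ‖densityFourier unitBump volume u‖ ≤ A / (1 + |u|) ^ 1)
    (hB : ∀ u, ‖densityFourier G volume u‖ ≤ B / (1 + |u|) ^ 5) (ξ : ℝ) :
    ‖densityFourier (fun x => G x * bumpRow (bumpWidth τ M) q x) volume ξ -
      densityFourier G volume ξ‖ ≤
      8 * A * B * M * ∑' m : ℤ, if (q : ℤ) ∣ m then frequencyTerm τ ξ m else 0 := by
  have hτ0 : 0 < τ := by linarith
  set ε := bumpWidth τ M with hεdef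
  have hε : 0 < ε := bumpWidth_pos τ hM
  have hqr : (0 : ℝ) < q := by exact_mod_cast hq0
  have hq4 : (q : ℝ) ≤ 4 * M := by exact_mod_cast hq
  have hMr : (0 : ℝ) < M := by exact_mod_cast hM
  have hsum := hasSum_densityFourier_mul_bumpRow hG ha hε hqa ξ
  have hsub : HasSum (fun n : ℤ => if n = 0 then 0 else densityFourier unitBump volume (ε * n) *
      densityFourier G volume (ξ - n * q))
      (densityFourier (fun x => G x * bumpRow ε q x) volume ξ - densityFourier G volume ξ) := by
    have h1 : HasSum (fun n : ℤ => if n = 0 then densityFourier G volume ξ else 0)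
        (densityFourier G volume ξ) := hasSum_ite_eq 0 _
    convert! hsum.sub h1 using 1
    ext n
    by_cases hn : n = 0
    · subst hn
      simp [densityFourier_unitBump_zero]
    · simp [hn]
  have hterm : ∀ n : ℤ, ‖(if n = 0 then 0 else densityFourier unitBump volume (ε * n) *
      densityFourier G volume (ξ - n * q) : ℂ)‖ ≤ 8 * A * B * M * frequencyTerm τ ξ (n * q) := by
    intro n
    by_cases hn : n = 0
    · simp [hn, frequencyTerm]
    have hn1 : 1 ≤ |(n : ℝ)| := by exact_mod_cast Int.one_le_abs hn
    have hnq : n * (q : ℤ) ≠ 0 := mul_ne_zero hn (by exact_mod_cast hq0.ne')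
    have hnq1 : 1 ≤ |((n * q : ℤ) : ℝ)| := by exact_mod_cast Int.one_le_abs hnq
    rw [if_neg hn, frequencyTerm, if_neg hnq, norm_mul]
    have key : A / (1 + |ε * n|) ^ 1 ≤ 8 * A * M * (1 + |((n * q : ℤ) : ℝ)|) ^ (-(1 / τ)) := by
      have e1 : (1 + |ε * n|) ^ (-1 : ℝ) ≤ (1 + |ε * n|) ^ (-(1 / τ)) := by
        refine Real.rpow_le_rpow_of_exponent_le (by linarith [abs_nonneg (ε * n)]) ?_
        rw [neg_le_neg_iff, div_le_one hτ0]
        exact hτ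
      -- Since `ε = (4M) ^ (1 - τ)` and `q ≤ 4M`, one has `ε |n| ≥ |n q| / (4M) ^ τ`. The power
      -- `-1/τ` of the denominator `2 (4M) ^ τ` is then at most `2 * 4M`.
      have e2 : (1 + |((n * q : ℤ) : ℝ)|) / (2 * (4 * M) ^ τ) ≤ 1 + |ε * n| := by
        rw [div_le_iff₀ (by positivity), abs_mul, abs_of_pos hε]
        have : ε * (4 * M : ℝ) ^ τ = 4 * M := by
          rw [hεdef, bumpWidth, ← Real.rpow_add (by positivity)]
          simp
        have h3 : |((n * q : ℤ) : ℝ)| ≤ |(n : ℝ)| * (4 * M) := by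
          push_cast
          rw [abs_mul, abs_of_pos hqr]
          exact mul_le_mul_of_nonneg_left hq4 (abs_nonneg _)
        have h4 : 0 < (4 * M : ℝ) ^ τ := by positivity
        nlinarith
      have e3 : (1 + |ε * n|) ^ (-(1 / τ)) ≤
          8 * M * (1 + |((n * q : ℤ) : ℝ)|) ^ (-(1 / τ)) := by
        calc _ ≤ ((1 + |((n * q : ℤ) : ℝ)|) / (2 * (4 * M) ^ τ)) ^ (-(1 / τ)) :=
              Real.rpow_le_rpow_of_nonpos (by positivity) e2 (by rw [neg_nonpos]; positivity)
          _ = (1 + |((n * q : ℤ) : ℝ)|) ^ (-(1 / τ)) * (2 ^ (1 / τ) * (4 * M)) := by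
              rw [Real.div_rpow (by positivity) (by positivity), div_eq_mul_inv,
                ← Real.rpow_neg (by positivity), neg_neg,
                Real.mul_rpow (by norm_num) (by positivity), ← Real.rpow_mul (by positivity),
                mul_one_div_cancel hτ0.ne', Real.rpow_one]
          _ ≤ (1 + |((n * q : ℤ) : ℝ)|) ^ (-(1 / τ)) * (2 * (4 * M)) := by
              refine mul_le_mul_of_nonneg_left (mul_le_mul_of_nonneg_right ?_ (by positivity))
                (by positivity)
              calc (2 : ℝ) ^ (1 / τ) ≤ 2 ^ (1 : ℝ) := by
                    refine Real.rpow_le_rpow_of_exponent_le one_le_two ?_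
                    rw [div_le_one hτ0]
                    exact hτ
                _ = 2 := Real.rpow_one _
          _ = _ := by ring
      rw [Real.rpow_neg_one] at e1
      rw [pow_one, div_eq_mul_inv]
      calc A * (1 + |ε * n|)⁻¹ ≤ A * (8 * M * (1 + |((n * q : ℤ) : ℝ)|) ^ (-(1 / τ))) :=
            mul_le_mul_of_nonneg_left (e1.trans e3) hA0.le
        _ = _ := by ring
    have hBn := hB (ξ - n * q)
    calc _ ≤ (8 * A * M * (1 + |((n * q : ℤ) : ℝ)|) ^ (-(1 / τ))) *
          (B / (1 + |ξ - n * q|) ^ 5) :=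
          mul_le_mul ((hA _).trans key) hBn (norm_nonneg _) (by positivity)
      _ = _ := by push_cast; ring
  have hinj : Function.Injective fun n : ℤ => n * (q : ℤ) :=
    mul_left_injective₀ (by exact_mod_cast hq0.ne')
  have hsf := summable_frequencyTerm hτ0 ξ
  have hs1 : Summable fun n : ℤ => frequencyTerm τ ξ (n * q) := hsf.comp_injective hinj
  have hreindex : ∑' n : ℤ, frequencyTerm τ ξ (n * q) =
      ∑' m : ℤ, if (q : ℤ) ∣ m then frequencyTerm τ ξ m else 0 := by
    rw [← hinj.tsum_eq (f := fun m : ℤ => if (q : ℤ) ∣ m then frequencyTerm τ ξ m else 0)]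
    · simp
    · intro m hm
      have : (q : ℤ) ∣ m := by
        by_contra h
        simp [h] at hm
      obtain ⟨k, rfl⟩ := this
      exact ⟨k, mul_comm _ _⟩
  rw [← hreindex, ← hsub.tsum_eq, ← tsum_mul_left]
  exact tsum_of_norm_bounded (hs1.mul_left _).hasSum hterm

/-- Multiplication by `bumpAverage` perturbs the Fourier transform of a density only by a small
multiple of the decay weight. -/
theorem eventually_norm_densityFourier_mul_bumpAverage_sub_le {G : ℝ → ℝ} (hG : IsSmoothDensity G)
    {τ η : ℝ} (hτ : 1 ≤ τ) (hη : 0 < η) :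
    ∀ᶠ M : ℕ in atTop, ∀ ξ, ‖densityFourier (fun x => G x * bumpAverage τ M x) volume ξ -
      densityFourier G volume ξ‖ ≤ η * decayWeight τ ξ := by
  have hτ0 : 0 < τ := by linarith
  obtain ⟨a, ha0, ha⟩ := hG.exists_margin
  obtain ⟨A, hA0, hA⟩ :=
    exists_densityFourier_decay contDiff_unitBump hasCompactSupport_unitBump 1
  obtain ⟨B, hB0, hB⟩ := exists_densityFourier_decay hG.contDiff hG.hasCompactSupport 5
  obtain ⟨C, hC0, hC⟩ := exists_tsum_inv_sq_le
  have hlog : Tendsto (fun M : ℕ => Real.log M) atTop atTop :=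
    Real.tendsto_log_atTop.comp tendsto_natCast_atTop_atTop
  -- The bound on `log M` is what the final estimate requires. The bound `1 / a ≤ M` gives `ε ≤ 1 ≤
  -- q a` for every prime of the block.
  filter_upwards [eventually_card_primeBlock, eventually_ge_atTop 2,
    hlog.eventually_ge_atTop (16 * A * B * C / η),
    tendsto_natCast_atTop_atTop.eventually_ge_atTop (1 / a)] with M hcard hM2 hMlog hMa ξ
  have hM : 0 < M := by omega
  have hMr : (0 : ℝ) < M := by exact_mod_cast hM
  have hlogM : 0 < Real.log M := Real.log_pos (by exact_mod_cast hM2)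
  set Q := primeBlock M with hQ
  have hcpos : (0 : ℝ) < Q.card := by
    by_contra h
    have : (Q.card : ℝ) = 0 := le_antisymm (not_lt.1 h) (by positivity)
    rw [this] at hcard
    linarith
  have hrow : ∀ q ∈ Q, ‖densityFourier (fun x => G x * bumpRow (bumpWidth τ M) q x) volume ξ -
      densityFourier G volume ξ‖ ≤
      8 * A * B * M * ∑' m : ℤ, if (q : ℤ) ∣ m then frequencyTerm τ ξ m else 0 := by
    intro q hq
    obtain ⟨⟨h1, h2⟩, h3⟩ := mem_primeBlock.1 hq
    refine norm_densityFourier_mul_bumpRow_sub_le hG hτ ha hM h3.pos h2 ?_ hA0 hA hB ξ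
    refine (bumpWidth_le_one hτ hM).trans ?_
    have : (M : ℝ) ≤ q := by exact_mod_cast h1.le
    rw [div_le_iff₀ ha0] at hMa
    nlinarith
  have hdecomp : densityFourier (fun x => G x * bumpAverage τ M x) volume ξ -
      densityFourier G volume ξ = (Q.card : ℂ)⁻¹ * ∑ q ∈ Q,
        (densityFourier (fun x => G x * bumpRow (bumpWidth τ M) q x) volume ξ -
          densityFourier G volume ξ) := by
    rw [Finset.sum_sub_distrib, Finset.sum_const, nsmul_eq_mul, mul_sub, ← mul_assoc,
      inv_mul_cancel₀ (by exact_mod_cast hcpos.ne'), one_mul]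
    congr 1
    unfold densityFourier
    rw [← integral_finsetSum, ← integral_const_mul]
    · congr 1
      ext x
      simp only [bumpAverage, ← hQ]
      push_cast
      rw [Finset.mul_sum, Finset.mul_sum, Finset.mul_sum, Finset.mul_sum]
      refine Finset.sum_congr rfl fun q _ => ?_
      ring
    · intro q _
      have := hG.mul (contDiff_bumpRow (bumpWidth τ M) q) (bumpRow_nonneg (bumpWidth_pos τ hM) q)
      refine this.integrable.ofReal.bdd_mul (c := 1) (by fun_prop) ?_
      exact Filter.Eventually.of_forall fun x => (norm_exp_neg_two_pi_mul x ξ).le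
  have hsf := summable_frequencyTerm hτ0 ξ
  have hswap : ∑ q ∈ Q, ∑' m : ℤ, (if (q : ℤ) ∣ m then frequencyTerm τ ξ m else 0) ≤
      decayWeight τ ξ / (Real.log M) ^ 2 * C := by
    rw [← Summable.tsum_finsetSum]
    -- The fifth power in `frequencyTerm` splits as 3 + 2: three factors pay for replacing the
    -- weight at `m` by the weight at `ξ`, and two make the sum over `m` converge.
    · have hle : ∀ m : ℤ, ∑ q ∈ Q, (if (q : ℤ) ∣ m then frequencyTerm τ ξ m else 0) ≤
          decayWeight τ ξ / (Real.log M) ^ 2 * ((1 + |ξ - m|) ^ 2)⁻¹ := by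
        intro m
        have hw := decayWeight_pos τ ξ
        by_cases hm : m = 0
        · simp only [frequencyTerm, hm, if_true, ite_self, Finset.sum_const_zero]
          positivity
        rw [← Finset.sum_filter, Finset.sum_const, nsmul_eq_mul, frequencyTerm, if_neg hm]
        have h1 := card_primeBlock_dvd_le hM2 hm
        have h2 := decayWeight_le_mul hτ m ξ
        have hpos : 0 < 1 + |ξ - m| := by positivity
        calc _ ≤ (1 + Real.log (1 + |(m : ℝ)|)) ^ 2 / (Real.log M) ^ 2 *
              ((1 + |(m : ℝ)|) ^ (-(1 / τ)) / (1 + |ξ - m|) ^ 5) :=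
              mul_le_mul_of_nonneg_right h1 (by positivity)
          _ = decayWeight τ m / ((Real.log M) ^ 2 * (1 + |ξ - m|) ^ 5) := by
              unfold decayWeight
              field_simp
          _ ≤ decayWeight τ ξ * (1 + |ξ - m|) ^ 3 / ((Real.log M) ^ 2 * (1 + |ξ - m|) ^ 5) :=
              div_le_div_of_nonneg_right h2 (by positivity)
          _ = _ := by field_simp
      have hs2 := (hC ξ).1.mul_left (decayWeight τ ξ / (Real.log M) ^ 2)
      calc _ ≤ ∑' m : ℤ, decayWeight τ ξ / (Real.log M) ^ 2 * ((1 + |ξ - m|) ^ 2)⁻¹ := by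
            refine Summable.tsum_le_tsum hle ?_ hs2
            refine Summable.of_nonneg_of_le (fun m => Finset.sum_nonneg fun q _ => ?_) hle hs2
            split_ifs
            · exact frequencyTerm_nonneg _ _ _
            · exact le_rfl
        _ = decayWeight τ ξ / (Real.log M) ^ 2 * ∑' m : ℤ, ((1 + |ξ - m|) ^ 2)⁻¹ := tsum_mul_left
        _ ≤ _ := by
            refine mul_le_mul_of_nonneg_left (hC ξ).2 ?_
            have := decayWeight_pos τ ξ
            positivity
    · intro q _
      refine Summable.of_nonneg_of_le (fun m => ?_) (fun m => ?_) hsf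
      · split_ifs
        · exact frequencyTerm_nonneg _ _ _
        · exact le_rfl
      · split_ifs
        · exact le_rfl
        · exact frequencyTerm_nonneg _ _ _
  rw [hdecomp, norm_mul, norm_inv, Complex.norm_natCast]
  have hw := decayWeight_pos τ ξ
  calc (Q.card : ℝ)⁻¹ * ‖∑ q ∈ Q, _‖ ≤ (Q.card : ℝ)⁻¹ * (8 * A * B * M *
        (decayWeight τ ξ / (Real.log M) ^ 2 * C)) := by
        refine mul_le_mul_of_nonneg_left ?_ (by positivity)
        refine (norm_sum_le _ _).trans ((Finset.sum_le_sum hrow).trans ?_)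
        rw [← Finset.mul_sum]
        exact mul_le_mul_of_nonneg_left hswap (by positivity)
    _ = 8 * A * B * C * decayWeight τ ξ / Real.log M * (M / (Q.card * Real.log M)) := by
        field_simp
    _ ≤ 8 * A * B * C * decayWeight τ ξ / Real.log M * 2 := by
        refine mul_le_mul_of_nonneg_left ?_ (by positivity)
        rw [div_le_iff₀ (by positivity)]
        linarith
    _ = 16 * A * B * C / Real.log M * decayWeight τ ξ := by ring
    _ ≤ η * decayWeight τ ξ := by
        refine mul_le_mul_of_nonneg_right ?_ hw.le
        rw [div_le_iff₀ hlogM]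
        rw [div_le_iff₀ hη] at hMlog
        linarith

/-! ### Multiplying a density by an average of bumps at rationals: interval masses -/

/-- Points at distance at least `σ` have distinct values of `⌊c / σ⌋`, so counting integers
suffices. -/
theorem card_le_of_separated {ι : Type*} (T : Finset ι) (c : ι → ℝ) {σ u v : ℝ} (hσ : 0 < σ)
    (huv : u ≤ v) (hsep : ∀ i ∈ T, ∀ j ∈ T, i ≠ j → σ ≤ |c i - c j|)
    (hc : ∀ i ∈ T, u ≤ c i ∧ c i ≤ v) : (T.card : ℝ) ≤ (v - u) / σ + 2 := by
  have hinj : Set.InjOn (fun i => ⌊c i / σ⌋) T := by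
    intro i hi j hj hij
    by_contra hne
    have h1 := hsep i hi j hj hne
    have h2 := Int.abs_sub_lt_one_of_floor_eq_floor hij
    rw [← sub_div, abs_div, abs_of_pos hσ, div_lt_one hσ] at h2
    linarith
  have h1 : T.card ≤ (Finset.Icc ⌊u / σ⌋ ⌊v / σ⌋).card := by
    rw [← Finset.card_image_of_injOn hinj]
    refine Finset.card_le_card fun n hn => ?_
    obtain ⟨i, hi, rfl⟩ := Finset.mem_image.1 hn
    rw [Finset.mem_Icc]
    exact ⟨Int.floor_le_floor (div_le_div_of_nonneg_right (hc i hi).1 hσ.le),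
      Int.floor_le_floor (div_le_div_of_nonneg_right (hc i hi).2 hσ.le)⟩
  rw [Int.card_Icc] at h1
  have h2 : ⌊u / σ⌋ ≤ ⌊v / σ⌋ := Int.floor_le_floor (div_le_div_of_nonneg_right huv hσ.le)
  have h3 : (T.card : ℤ) ≤ ⌊v / σ⌋ + 1 - ⌊u / σ⌋ := by omega
  have h4 : (T.card : ℝ) ≤ ⌊v / σ⌋ + 1 - ⌊u / σ⌋ := by exact_mod_cast h3
  have h5 := Int.floor_le (v / σ)
  have h6 := Int.lt_floor_add_one (u / σ)
  rw [sub_div]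
  linarith

/-- The mass of separated, localized functions in an interval is bounded by counting. -/
theorem sum_integral_le_of_separated {ι : Type*} (T : Finset ι) (c : ι → ℝ) (b : ι → ℝ → ℝ)
    {σ ρ m x y : ℝ} (hσ : 0 < σ) (hρ : 0 ≤ ρ) (hm : 0 ≤ m) (hxy : x ≤ y)
    (hsep : ∀ i ∈ T, ∀ j ∈ T, i ≠ j → σ ≤ |c i - c j|)
    (hb : ∀ i ∈ T, ∫ t in x..y, b i t ≤ m)
    (hb0 : ∀ i ∈ T, ¬ (x - ρ ≤ c i ∧ c i ≤ y + ρ) → ∫ t in x..y, b i t = 0) :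
    ∑ i ∈ T, ∫ t in x..y, b i t ≤ ((y - x + 2 * ρ) / σ + 2) * m := by
  classical
  set S := T.filter fun i => x - ρ ≤ c i ∧ c i ≤ y + ρ with hS
  have h1 : ∑ i ∈ T, ∫ t in x..y, b i t = ∑ i ∈ S, ∫ t in x..y, b i t := by
    rw [hS, Finset.sum_filter]
    refine Finset.sum_congr rfl fun i hi => ?_
    split_ifs with h
    · rfl
    · exact hb0 i hi h
  have h2 : (S.card : ℝ) ≤ (y + ρ - (x - ρ)) / σ + 2 :=
    card_le_of_separated S c hσ (by linarith)
      (fun i hi j hj => hsep i (Finset.mem_filter.1 hi).1 j (Finset.mem_filter.1 hj).1)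
      (fun i hi => (Finset.mem_filter.1 hi).2)
  rw [h1]
  calc _ ≤ S.card • m := Finset.sum_le_card_nsmul _ _ _ fun i hi => hb i (Finset.mem_filter.1 hi).1
    _ = S.card * m := nsmul_eq_mul _ _
    _ ≤ _ := by
        refine mul_le_mul_of_nonneg_right (h2.trans (le_of_eq ?_)) hm
        ring

theorem continuous_scaledBump_affine (ε q c : ℝ) : Continuous fun t => scaledBump ε (q * t - c) :=
  (contDiff_scaledBump ε).continuous.comp (by fun_prop)

/-- Otherwise the integral would take its default value 0, while it equals `q⁻¹`. -/
theorem integrable_scaledBump_affine {ε q : ℝ} (hε : 0 < ε) (hq : 0 < q) (c : ℝ) :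
    Integrable fun t => scaledBump ε (q * t - c) := by
  by_contra h
  have h1 := integral_undef h
  rw [integral_scaledBump hε hq c] at h1
  exact (inv_pos.2 hq).ne' h1

theorem intervalIntegral_scaledBump_nonneg {ε q c x y : ℝ} (hε : 0 < ε) (hxy : x ≤ y) :
    0 ≤ ∫ t in x..y, scaledBump ε (q * t - c) :=
  intervalIntegral.integral_nonneg hxy fun _ _ => scaledBump_nonneg hε _

theorem intervalIntegral_scaledBump_le_inv {ε q c x y : ℝ} (hε : 0 < ε) (hq : 0 < q)
    (hxy : x ≤ y) : ∫ t in x..y, scaledBump ε (q * t - c) ≤ q⁻¹ := by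
  rw [← integral_scaledBump hε hq c, intervalIntegral.integral_of_le hxy]
  exact setIntegral_le_integral (integrable_scaledBump_affine hε hq c)
    (Filter.Eventually.of_forall fun t => scaledBump_nonneg hε _)

theorem intervalIntegral_scaledBump_le_mul {A ε q c x y : ℝ} (hA : ∀ x, unitBump x ≤ A)
    (hε : 0 < ε) (hxy : x ≤ y) : ∫ t in x..y, scaledBump ε (q * t - c) ≤ A / ε * (y - x) := by
  calc _ ≤ ∫ _ in x..y, A / ε := by
        refine intervalIntegral.integral_mono_on hxy
          ((continuous_scaledBump_affine _ _ _).intervalIntegrable _ _)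
          (continuous_const.intervalIntegrable _ _) fun t _ => scaledBump_le hA hε _
    _ = _ := by rw [intervalIntegral.integral_const, smul_eq_mul, mul_comm]

theorem intervalIntegral_scaledBump_eq_zero {ε q c x y : ℝ} (hε : 0 < ε) (hq : 0 < q)
    (hxy : x ≤ y) (h : ¬ (x - ε / q ≤ c / q ∧ c / q ≤ y + ε / q)) :
    ∫ t in x..y, scaledBump ε (q * t - c) = 0 := by
  have h0 : ∀ t ∈ Set.uIcc x y, scaledBump ε (q * t - c) = 0 := by
    intro t ht
    rw [Set.uIcc_of_le hxy] at ht
    apply scaledBump_eq_zero hε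
    by_contra hlt
    apply h
    have h1 := abs_lt.1 (not_le.1 hlt)
    have h2 : q * x ≤ q * t := mul_le_mul_of_nonneg_left ht.1 hq.le
    have h3 : q * t ≤ q * y := mul_le_mul_of_nonneg_left ht.2 hq.le
    constructor
    · rw [sub_le_iff_le_add, ← add_div, le_div_iff₀ hq]
      linarith [h1.2]
    · rw [← sub_le_iff_le_add, ← sub_div, div_le_iff₀ hq]
      linarith [h1.1]
  rw [intervalIntegral.integral_congr h0]
  simp

theorem intervalIntegral_scaledBump_eq_inv {ε q c x y : ℝ} (hε : 0 < ε) (hq : 0 < q)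
    (hxy : x ≤ y) (hx : q * x ≤ c - ε) (hy : c + ε ≤ q * y) :
    ∫ t in x..y, scaledBump ε (q * t - c) = q⁻¹ := by
  rw [← integral_scaledBump hε hq c, intervalIntegral.integral_of_le hxy]
  apply setIntegral_eq_integral_of_forall_compl_eq_zero
  intro t ht
  apply scaledBump_eq_zero hε
  rw [Set.mem_Ioc, not_and_or, not_lt, not_le] at ht
  rcases ht with ht | ht
  · have : q * t ≤ q * x := mul_le_mul_of_nonneg_left ht hq.le
    rw [abs_sub_comm]
    exact le_trans (by linarith) (le_abs_self _)
  · have : q * y ≤ q * t := mul_le_mul_of_nonneg_left ht.le hq.le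
    exact le_trans (by linarith) (le_abs_self _)

theorem intervalIntegral_bumpRow (ε : ℝ) (q : ℕ) (x y : ℝ) :
    ∫ t in x..y, bumpRow ε q t = ∑ r ∈ Finset.Ico 1 q, ∫ t in x..y, scaledBump ε (q * t - r) :=
  intervalIntegral.integral_finsetSum fun _ _ =>
    (continuous_scaledBump_affine _ _ _).intervalIntegrable _ _

theorem intervalIntegral_bumpAverage (τ : ℝ) (M : ℕ) (x y : ℝ) :
    ∫ t in x..y, bumpAverage τ M t = ((primeBlock M).card : ℝ)⁻¹ *
      ∑ q ∈ primeBlock M, ∫ t in x..y, bumpRow (bumpWidth τ M) q t := by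
  unfold bumpAverage
  rw [intervalIntegral.integral_const_mul, intervalIntegral.integral_finsetSum]
  exact fun q _ => (contDiff_bumpRow _ _).continuous.intervalIntegrable _ _

/-- Distinct pairs give distinct fractions, because `0 < r < q` with `q` prime excludes `q ∣ r`. The
difference then has a nonzero integer numerator and a denominator at most `(4M) ^ 2`. -/
theorem primeBlock_fractions_separated {M : ℕ} {i j : Σ _ : ℕ, ℕ}
    (hi : i ∈ (primeBlock M).sigma fun q => Finset.Ico 1 q)
    (hj : j ∈ (primeBlock M).sigma fun q => Finset.Ico 1 q) (hij : i ≠ j) :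
    1 / (16 * (M : ℝ) ^ 2) ≤ |(i.2 : ℝ) / i.1 - j.2 / j.1| := by
  obtain ⟨q, r⟩ := i
  obtain ⟨q', r'⟩ := j
  rw [Finset.mem_sigma, mem_primeBlock, Finset.mem_Ico] at hi hj
  obtain ⟨⟨⟨h1, h2⟩, h3⟩, h4, h5⟩ := hi
  obtain ⟨⟨⟨h1', h2'⟩, h3'⟩, h4', h5'⟩ := hj
  simp only at *
  have hq : (0 : ℝ) < q := by exact_mod_cast h3.pos
  have hq' : (0 : ℝ) < q' := by exact_mod_cast h3'.pos
  have hne : (r * q' : ℤ) - q * r' ≠ 0 := by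
    intro h
    have h0 : r * q' = q * r' := by
      have : (r * q' : ℤ) = q * r' := by linarith
      exact_mod_cast this
    by_cases hqq : q = q'
    · subst hqq
      rw [mul_comm] at h0
      exact hij (by rw [Nat.eq_of_mul_eq_mul_left h3.pos h0])
    · have hd : q ∣ r * q' := ⟨r', h0⟩
      have := ((Nat.coprime_primes h3 h3').2 hqq).dvd_of_dvd_mul_right hd
      exact absurd (Nat.le_of_dvd (by omega) this) (by omega)
  have h6 : (1 : ℝ) ≤ |(r * q' : ℝ) - q * r'| := by exact_mod_cast Int.one_le_abs hne
  rw [div_sub_div _ _ hq.ne' hq'.ne', abs_div, abs_of_pos (mul_pos hq hq')]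
  refine div_le_div₀ (abs_nonneg _) h6 (mul_pos hq hq') ?_
  have e1 : (q : ℝ) ≤ 4 * M := by exact_mod_cast h2
  have e2 : (q' : ℝ) ≤ 4 * M := by exact_mod_cast h2'
  calc (q : ℝ) * q' ≤ (4 * M) * (4 * M) := mul_le_mul e1 e2 hq'.le (by positivity)
    _ = _ := by ring

/-- An interval of length `ℓ` meets at most `16 M² ℓ + 10` bumps, each of mass at most `min (1/M) (A
ℓ / ε)`, and there are at least `M / (2 log M)` primes to average over. -/
theorem exists_integral_bumpAverage_le {τ : ℝ} (hτ : 2 ≤ τ) :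
    ∃ C : ℝ, 0 < C ∧ ∀ M : ℕ, 2 ≤ M → (M : ℝ) / 2 ≤ (primeBlock M).card * Real.log M →
      ∀ x y : ℝ, x < y → y - x ≤ 1 →
        ∫ t in x..y, bumpAverage τ M t ≤ C * Real.log M * (y - x) ^ (2 / τ) := by
  obtain ⟨A, hA1, hA⟩ := exists_unitBump_le
  have hτ0 : 0 < τ := by linarith
  refine ⟨2 * (16 + 10 * (16 * A)), by positivity, fun M hM2 hcard x y hxy hxy1 => ?_⟩
  have hM : 0 < M := by omega
  have hMr : (0 : ℝ) < M := by exact_mod_cast hM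
  have hM1 : (1 : ℝ) ≤ M := by exact_mod_cast hM
  have hlogM : 0 < Real.log M := Real.log_pos (by exact_mod_cast hM2)
  set ℓ := y - x with hℓ
  have hℓ0 : 0 < ℓ := by linarith
  set ε := bumpWidth τ M with hεdef
  have hε : 0 < ε := bumpWidth_pos τ hM
  set Q := primeBlock M with hQ
  have hcpos : (0 : ℝ) < Q.card := by
    by_contra h
    have : (Q.card : ℝ) = 0 := le_antisymm (not_lt.1 h) (by positivity)
    rw [this] at hcard
    linarith
  set m := min (1 / (M : ℝ)) (A / ε * ℓ) with hm
  have hm0 : 0 ≤ m := by positivity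
  have hεM : ε * (4 * M) ^ τ = 4 * M := by
    rw [hεdef, bumpWidth, ← Real.rpow_add (by positivity)]
    simp
  have hε4 : ε * (4 * M) ≤ 1 := by
    have : (4 * M : ℝ) ^ (2 : ℝ) ≤ (4 * M : ℝ) ^ τ :=
      Real.rpow_le_rpow_of_exponent_le (by linarith) hτ
    rw [Real.rpow_two] at this
    have h2 : ε * (4 * M) ^ 2 ≤ 4 * M := (mul_le_mul_of_nonneg_left this hε.le).trans_eq hεM
    have h3 : (ε * (4 * M)) * (4 * M) ≤ 1 * (4 * M) := by linarith
    exact le_of_mul_le_mul_right h3 (by positivity)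
  have hsum : ∑ q ∈ Q, ∫ t in x..y, bumpRow ε q t ≤
      ((y - x + 2 * (ε / M)) / (1 / (16 * (M : ℝ) ^ 2)) + 2) * m := by
    simp_rw [intervalIntegral_bumpRow]
    rw [Finset.sum_sigma' Q (fun q => Finset.Ico 1 q)
      (fun q r => ∫ t in x..y, scaledBump ε (q * t - r))]
    refine sum_integral_le_of_separated (Q.sigma fun q => Finset.Ico 1 q)
      (fun i => (i.2 : ℝ) / i.1) (fun i t => scaledBump ε (i.1 * t - i.2)) (by positivity)
      (by positivity) hm0 hxy.le (fun i hi j hj => primeBlock_fractions_separated hi hj) ?_ ?_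
    · rintro ⟨q, r⟩ hi
      rw [Finset.mem_sigma, mem_primeBlock] at hi
      have hq : (M : ℝ) ≤ q := by exact_mod_cast hi.1.1.1.le
      refine le_min ?_ (intervalIntegral_scaledBump_le_mul hA hε hxy.le)
      refine (intervalIntegral_scaledBump_le_inv hε (by linarith) hxy.le).trans ?_
      rw [one_div]
      exact inv_anti₀ hMr hq
    · rintro ⟨q, r⟩ hi h
      rw [Finset.mem_sigma, mem_primeBlock] at hi
      have hq : (M : ℝ) ≤ q := by exact_mod_cast hi.1.1.1.le
      refine intervalIntegral_scaledBump_eq_zero hε (by linarith) hxy.le fun h' => h ?_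
      have : ε / q ≤ ε / M := div_le_div_of_nonneg_left hε.le hMr hq
      exact ⟨by linarith [h'.1], by linarith [h'.2]⟩
  -- The two bounds in `m` cross at the physical bump width `(4M) ^ (-τ)`, where `ℓ ^ (2/τ)` is
  -- comparable to `1 / M²`.
  have hz : m / M ≤ 16 * A * ℓ ^ (2 / τ) := by
    have h4M : ((4 * M : ℝ) ^ (-τ)) ^ (2 / τ) = ((4 * M : ℝ) ^ 2)⁻¹ := by
      rw [← Real.rpow_mul (by positivity), ← Real.rpow_two, ← Real.rpow_neg (by positivity)]
      congr 1
      field_simp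
    rcases le_total ((4 * M : ℝ) ^ (-τ)) ℓ with h | h
    · have h1 := Real.rpow_le_rpow (by positivity) h (show 0 ≤ 2 / τ by positivity)
      rw [h4M] at h1
      calc m / M ≤ 1 / M / M := div_le_div_of_nonneg_right (min_le_left _ _) hMr.le
        _ = 16 * ((4 * M : ℝ) ^ 2)⁻¹ := by field_simp; norm_num
        _ ≤ 16 * ℓ ^ (2 / τ) := by linarith
        _ ≤ 16 * A * ℓ ^ (2 / τ) := by
            refine mul_le_mul_of_nonneg_right ?_ (by positivity)
            linarith
    · set D := (4 * M : ℝ) ^ (-τ) with hD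
      have hD0 : 0 < D := by positivity
      have hεD : ε = 4 * M * D := by
        rw [hεdef, bumpWidth, hD, sub_eq_add_neg, Real.rpow_add (by positivity), Real.rpow_one]
      have h1 : ℓ / D ≤ (ℓ / D) ^ (2 / τ) := by
        conv_lhs => rw [← Real.rpow_one (ℓ / D)]
        refine Real.rpow_le_rpow_of_exponent_ge (by positivity) ?_ ?_
        · rw [div_le_one hD0]; exact h
        · rw [div_le_one hτ0]; exact hτ
      rw [Real.div_rpow hℓ0.le hD0.le, h4M] at h1
      calc m / M ≤ A / ε * ℓ / M := div_le_div_of_nonneg_right (min_le_right _ _) hMr.le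
        _ = A / (4 * M ^ 2) * (ℓ / D) := by rw [hεD]; field_simp
        _ ≤ A / (4 * M ^ 2) * (ℓ ^ (2 / τ) / ((4 * M : ℝ) ^ 2)⁻¹) :=
            mul_le_mul_of_nonneg_left h1 (by positivity)
        _ = 4 * A * ℓ ^ (2 / τ) := by field_simp
        _ ≤ 16 * A * ℓ ^ (2 / τ) := by
            refine mul_le_mul_of_nonneg_right ?_ (by positivity)
            linarith
  have hℓθ : ℓ ≤ ℓ ^ (2 / τ) := by
    conv_lhs => rw [← Real.rpow_one ℓ]
    refine Real.rpow_le_rpow_of_exponent_ge hℓ0 hxy1 ?_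
    rw [div_le_one hτ0]
    exact hτ
  have hcinv : (Q.card : ℝ)⁻¹ ≤ 2 * Real.log M / M := by
    rw [inv_eq_one_div, div_le_div_iff₀ hcpos hMr]
    linarith
  rw [intervalIntegral_bumpAverage]
  have hrhs : ((y - x + 2 * (ε / M)) / (1 / (16 * (M : ℝ) ^ 2)) + 2) * m ≤
      M * (16 * ℓ + 10 * (m / M)) := by
    have e1 : (y - x + 2 * (ε / M)) / (1 / (16 * (M : ℝ) ^ 2)) + 2 =
        16 * M ^ 2 * ℓ + 8 * (ε * (4 * M)) + 2 := by
      rw [← hℓ]; field_simp; ring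
    rw [e1]
    have e2 : m ≤ 1 / M := min_le_left _ _
    calc _ = 16 * M ^ 2 * ℓ * m + (8 * (ε * (4 * M)) + 2) * m := by ring
      _ ≤ 16 * M ^ 2 * ℓ * (1 / M) + 10 * m := by
          refine add_le_add (mul_le_mul_of_nonneg_left e2 (by positivity))
            (mul_le_mul_of_nonneg_right (by linarith) hm0)
      _ = _ := by field_simp
  calc _ ≤ 2 * Real.log M / M * (M * (16 * ℓ + 10 * (m / M))) :=
        mul_le_mul hcinv (hsum.trans hrhs) (Finset.sum_nonneg fun q _ =>
          intervalIntegral.integral_nonneg hxy.le fun t _ => bumpRow_nonneg hε _ _) (by positivity)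
    _ = 2 * Real.log M * (16 * ℓ + 10 * (m / M)) := by field_simp
    _ ≤ 2 * Real.log M * (16 * ℓ ^ (2 / τ) + 10 * (16 * A * ℓ ^ (2 / τ))) := by
        refine mul_le_mul_of_nonneg_left ?_ (by positivity)
        linarith
    _ = _ := by ring

/-- Every bump has mass `1/q`. Those with `r ≤ q x - 1` lie inside `[0, x]` and those with `r > q x
+ 1` lie outside, so only the count of `r` matters. -/
theorem abs_integral_bumpRow_sub_le {ε : ℝ} (hε : 0 < ε) (hε1 : ε ≤ 1) {q : ℕ} (hq : 0 < q) {x : ℝ}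
    (hx0 : 0 ≤ x) (hx1 : x ≤ 1) : |(∫ t in (0 : ℝ)..x, bumpRow ε q t) - x| ≤ 2 / q := by
  have hqr : (0 : ℝ) < q := by exact_mod_cast hq
  have hqx : 0 ≤ q * x := by positivity
  rw [intervalIntegral_bumpRow]
  have hub : ∑ r ∈ Finset.Ico 1 q, ∫ t in (0 : ℝ)..x, scaledBump ε (q * t - r) ≤
      (q * x + 1) * (q : ℝ)⁻¹ := by
    calc _ ≤ ∑ r ∈ (Finset.Ico 1 q).filter (fun r : ℕ => (r : ℝ) ≤ q * x + 1), (q : ℝ)⁻¹ := by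
          rw [Finset.sum_filter]
          refine Finset.sum_le_sum fun r _ => ?_
          split_ifs with h
          · exact intervalIntegral_scaledBump_le_inv hε hqr hx0
          · refine (intervalIntegral_scaledBump_eq_zero hε hqr hx0 fun h' => h ?_).le
            have := h'.2
            rw [← sub_le_iff_le_add, ← sub_div, div_le_iff₀ hqr] at this
            linarith
      _ = ((Finset.Ico 1 q).filter (fun r : ℕ => (r : ℝ) ≤ q * x + 1)).card * (q : ℝ)⁻¹ := by
          rw [Finset.sum_const, nsmul_eq_mul]
      _ ≤ _ := by
          refine mul_le_mul_of_nonneg_right ?_ (by positivity)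
          have h1 : ((Finset.Ico 1 q).filter (fun r : ℕ => (r : ℝ) ≤ q * x + 1)).card ≤
              (Finset.Icc 1 ⌊q * x + 1⌋₊).card := by
            refine Finset.card_le_card fun r hr => ?_
            rw [Finset.mem_filter, Finset.mem_Ico] at hr
            rw [Finset.mem_Icc]
            exact ⟨hr.1.1, Nat.le_floor hr.2⟩
          rw [Nat.card_Icc, Nat.add_sub_cancel] at h1
          calc _ ≤ (⌊q * x + 1⌋₊ : ℝ) := by exact_mod_cast h1
            _ ≤ _ := Nat.floor_le (by positivity)
  have hlb : (q * x - 2) * (q : ℝ)⁻¹ ≤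
      ∑ r ∈ Finset.Ico 1 q, ∫ t in (0 : ℝ)..x, scaledBump ε (q * t - r) := by
    calc _ ≤ ((Finset.Ico 1 q).filter (fun r : ℕ => (r : ℝ) ≤ q * x - 1)).card * (q : ℝ)⁻¹ := by
          refine mul_le_mul_of_nonneg_right ?_ (by positivity)
          have h1 : (Finset.Icc 1 ⌊q * x - 1⌋₊).card ≤
              ((Finset.Ico 1 q).filter (fun r : ℕ => (r : ℝ) ≤ q * x - 1)).card := by
            refine Finset.card_le_card fun r hr => ?_
            rw [Finset.mem_Icc] at hr
            have h2 := (Nat.le_floor_iff' (by omega)).1 hr.2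
            rw [Finset.mem_filter, Finset.mem_Ico]
            refine ⟨⟨hr.1, ?_⟩, h2⟩
            have : (r : ℝ) < q := by nlinarith
            exact_mod_cast this
          rw [Nat.card_Icc, Nat.add_sub_cancel] at h1
          -- If `q x < 1`, the natural floor is 0 and the inequality still holds.
          calc (q * x - 2 : ℝ) ≤ ⌊q * x - 1⌋₊ := by
                have := Nat.lt_floor_add_one (q * x - 1)
                linarith
            _ ≤ _ := by exact_mod_cast h1
      _ = ∑ r ∈ (Finset.Ico 1 q).filter (fun r : ℕ => (r : ℝ) ≤ q * x - 1), (q : ℝ)⁻¹ := by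
          rw [Finset.sum_const, nsmul_eq_mul]
      _ ≤ _ := by
          rw [Finset.sum_filter]
          refine Finset.sum_le_sum fun r hr => ?_
          split_ifs with h
          · have h1 : (1 : ℝ) ≤ r := by exact_mod_cast (Finset.mem_Ico.1 hr).1
            exact (intervalIntegral_scaledBump_eq_inv hε hqr hx0 (by linarith) (by linarith)).ge
          · exact intervalIntegral_scaledBump_nonneg hε hx0
  have e1 : (q * x + 1) * (q : ℝ)⁻¹ = x + 1 / q := by field_simp
  have e2 : (q * x - 2) * (q : ℝ)⁻¹ = x - 2 / q := by field_simp
  have e3 : (2 : ℝ) / q = 1 / q + 1 / q := by ring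
  have e4 : 0 < 1 / (q : ℝ) := by positivity
  rw [abs_le]
  constructor <;> linarith

theorem abs_integral_bumpAverage_sub_le {τ : ℝ} (hτ : 1 ≤ τ) {M : ℕ} (hM : 0 < M)
    (hQ : 0 < (primeBlock M).card) {x : ℝ} (hx0 : 0 ≤ x) (hx1 : x ≤ 1) :
    |(∫ t in (0 : ℝ)..x, bumpAverage τ M t) - x| ≤ 2 / M := by
  have hMr : (0 : ℝ) < M := by exact_mod_cast hM
  have hc : (0 : ℝ) < (primeBlock M).card := by exact_mod_cast hQ
  rw [intervalIntegral_bumpAverage]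
  have e : ((primeBlock M).card : ℝ)⁻¹ *
      ∑ q ∈ primeBlock M, (∫ t in (0 : ℝ)..x, bumpRow (bumpWidth τ M) q t) - x =
      ((primeBlock M).card : ℝ)⁻¹ *
      ∑ q ∈ primeBlock M, ((∫ t in (0 : ℝ)..x, bumpRow (bumpWidth τ M) q t) - x) := by
    rw [Finset.sum_sub_distrib, Finset.sum_const, nsmul_eq_mul, mul_sub]
    field_simp
  rw [e, abs_mul, abs_of_pos (inv_pos.2 hc), inv_mul_le_iff₀ hc]
  refine (Finset.abs_sum_le_sum_abs _ _).trans ?_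
  rw [← nsmul_eq_mul]
  refine Finset.sum_le_card_nsmul _ _ _ fun q hq => ?_
  obtain ⟨⟨h1, -⟩, h3⟩ := mem_primeBlock.1 hq
  refine (abs_integral_bumpRow_sub_le (bumpWidth_pos τ hM) (bumpWidth_le_one hτ hM) h3.pos
    hx0 hx1).trans ?_
  exact div_le_div_of_nonneg_left (by norm_num) hMr (by exact_mod_cast h1.le)

/-- Integration by parts moves the oscillation onto the primitive `V` of `bumpAverage - 1`, which is
at most `2 / M` on `[0, 1]`. Outside that interval `G` and its derivative vanish. -/
theorem exists_integral_mul_bumpAverage_sub_le {G : ℝ → ℝ} (hG : IsSmoothDensity G) {τ : ℝ}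
    (hτ : 1 ≤ τ) : ∃ C : ℝ, 0 < C ∧ ∀ M : ℕ, 0 < M → 0 < (primeBlock M).card →
      ∀ x y : ℝ, x < y → y - x ≤ 1 →
        (∫ t in x..y, G t * bumpAverage τ M t) - ∫ t in x..y, G t ≤ C / M := by
  obtain ⟨B, hB1, hB⟩ := hG.exists_le
  have hd : Continuous (deriv G) := hG.contDiff.continuous_deriv (by simp)
  obtain ⟨D, hD⟩ := hd.bounded_above_of_compact_support hG.hasCompactSupport.deriv
  have hD0 : 0 ≤ D := (norm_nonneg _).trans (hD 0)
  refine ⟨4 * B + 2 * D, by positivity, fun M hM hQ x y hxy hxy1 => ?_⟩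
  have hMr : (0 : ℝ) < M := by exact_mod_cast hM
  have hFc : Continuous (bumpAverage τ M) := (contDiff_bumpAverage τ M).continuous
  have hFc1 : Continuous fun t => bumpAverage τ M t - 1 := hFc.sub continuous_const
  set V : ℝ → ℝ := fun t => ∫ u in (0 : ℝ)..t, (bumpAverage τ M u - 1) with hV
  have hVd : ∀ t, HasDerivAt V (bumpAverage τ M t - 1) t := fun t =>
    (hFc1.integral_hasStrictDerivAt 0 t).hasDerivAt
  have hVb : ∀ t, 0 ≤ t → t ≤ 1 → |V t| ≤ 2 / M := by
    intro t h0 h1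
    have := abs_integral_bumpAverage_sub_le hτ hM hQ h0 h1
    rw [hV]
    simp only
    rw [intervalIntegral.integral_sub (hFc.intervalIntegrable _ _)
      (continuous_const.intervalIntegrable _ _)]
    simpa using this
  have hGV : ∀ t, |G t * V t| ≤ B * (2 / M) := by
    intro t
    by_cases h : G t = 0
    · rw [h, zero_mul, abs_zero]; positivity
    · have := hG.tsupport_subset (subset_tsupport G (Function.mem_support.2 h))
      rw [abs_mul, abs_of_nonneg (hG.nonneg t)]
      exact mul_le_mul (hB t) (hVb t this.1.le this.2.le) (abs_nonneg _) (by positivity)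
  have hG'V : ∀ t, |deriv G t * V t| ≤ D * (2 / M) := by
    intro t
    by_cases h : deriv G t = 0
    · rw [h, zero_mul, abs_zero]; positivity
    · have := hG.tsupport_subset (support_deriv_subset (Function.mem_support.2 h))
      rw [abs_mul]
      exact mul_le_mul (hD t) (hVb t this.1.le this.2.le) (abs_nonneg _) hD0
  have hibp := intervalIntegral.integral_mul_deriv_eq_deriv_mul (a := x) (b := y)
    (u := G) (v := V) (u' := deriv G) (v' := fun t => bumpAverage τ M t - 1)
    (fun t _ => ((hG.contDiff.differentiable (by simp)) t).hasDerivAt) (fun t _ => hVd t)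
    (hd.intervalIntegrable _ _) (hFc1.intervalIntegrable _ _)
  have hint : |∫ t in x..y, deriv G t * V t| ≤ D * (2 / M) := by
    have := intervalIntegral.norm_integral_le_of_norm_le_const (a := x) (b := y)
      (f := fun t => deriv G t * V t) (C := D * (2 / M)) (fun t _ => hG'V t)
    rw [Real.norm_eq_abs, abs_of_pos (by linarith : 0 < y - x)] at this
    exact this.trans (mul_le_of_le_one_right (by positivity) hxy1)
  have hsub := intervalIntegral.integral_sub (a := x) (b := y) (μ := volume)
    (f := fun t => G t * bumpAverage τ M t) (g := G)
    ((hG.continuous.mul hFc).intervalIntegrable _ _) (hG.continuous.intervalIntegrable _ _)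
  have e : (fun t => G t * bumpAverage τ M t - G t) = fun t => G t * (bumpAverage τ M t - 1) := by
    ext t; ring
  rw [← hsub, e, hibp]
  have a1 := (abs_le.1 (hGV y)).2
  have a2 := (abs_le.1 (hGV x)).1
  have a3 := (abs_le.1 hint).1
  have a4 : (4 * B + 2 * D) / M = B * (2 / M) + B * (2 / M) + D * (2 / M) := by ring
  linarith

/-- Neither available estimate suffices at all lengths: the equidistribution error `C₁ / M` is too
large for short intervals, and the counting bound carries a factor `log M`, which only a short
length absorbs through the spare exponent `2/τ - s`. -/
theorem eventually_integral_mul_bumpAverage_le {G : ℝ → ℝ} (hG : IsSmoothDensity G) {τ s η : ℝ}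
    (hτ : 2 ≤ τ) (hs0 : 0 < s) (hs : s < 2 / τ) (hη : 0 < η) :
    ∀ᶠ M : ℕ in atTop, ∀ x y : ℝ, x < y → y - x ≤ 1 →
      ∫ t in x..y, G t * bumpAverage τ M t ≤ (∫ t in x..y, G t) + η * (y - x) ^ s := by
  obtain ⟨C₁, hC₁, h1⟩ := exists_integral_mul_bumpAverage_sub_le hG (show 1 ≤ τ by linarith)
  obtain ⟨C₂, hC₂, h2⟩ := exists_integral_bumpAverage_le hτ
  obtain ⟨B, hB1, hB⟩ := hG.exists_le
  have hτ0 : 0 < τ := by linarith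
  have hs1 : s < 1 := hs.trans_le (by rw [div_le_one hτ0]; exact hτ)
  set κ := (2 / τ - s) / 2 with hκ
  have hκ0 : 0 < κ := by rw [hκ]; linarith
  have hlarge : ∀ᶠ M : ℕ in atTop, C₁ / η ≤ (M : ℝ) ^ (1 - s / 2) :=
    ((tendsto_rpow_atTop (by linarith)).comp tendsto_natCast_atTop_atTop).eventually_ge_atTop _
  have hsmall : ∀ᶠ M : ℕ in atTop, Real.log M ≤ η / (B * C₂) * (M : ℝ) ^ κ := by
    have := (isLittleO_log_rpow_atTop hκ0).bound (show 0 < η / (B * C₂) by positivity)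
    filter_upwards [tendsto_natCast_atTop_atTop.eventually this, eventually_ge_atTop 1] with M hM h1M
    have h1M' : (1 : ℝ) ≤ M := by exact_mod_cast h1M
    rwa [Real.norm_of_nonneg (Real.log_nonneg h1M'), Real.norm_of_nonneg (by positivity)] at hM
  filter_upwards [hlarge, hsmall, eventually_card_primeBlock, eventually_ge_atTop 2] with
    M hl hsm hcard hM2 x y hxy hxy1
  have hM : 0 < M := by omega
  have hMr : (0 : ℝ) < M := by exact_mod_cast hM
  set ℓ := y - x with hℓ
  have hℓ0 : 0 < ℓ := by linarith
  have hQ : 0 < (primeBlock M).card := by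
    rcases Nat.eq_zero_or_pos (primeBlock M).card with h | h
    · rw [h] at hcard
      simp only [CharP.cast_eq_zero, zero_mul] at hcard
      linarith
    · exact h
  -- At the threshold `ℓ = M ^ (-1/2)`, `C₁ / M` is below `η ℓ ^ s` because `s < 2`, and `ℓ ^ (2/τ -
  -- s)` is the negative power `M ^ (-κ)`.
  rcases le_total ((M : ℝ) ^ (-(1 / 2) : ℝ)) ℓ with h | h
  · have h3 := h1 M hM hQ x y hxy hxy1
    have h4 : C₁ / M ≤ η * ℓ ^ s := by
      have e1 := Real.rpow_le_rpow (by positivity) h hs0.le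
      rw [← Real.rpow_mul hMr.le] at e1
      have e2 : (M : ℝ) ^ (1 - s / 2) = M * (M : ℝ) ^ (-(1 / 2) * s) := by
        rw [show (1 - s / 2) = 1 + (-(1 / 2) * s) by ring, Real.rpow_add hMr, Real.rpow_one]
      rw [e2, div_le_iff₀ hη] at hl
      rw [div_le_iff₀ hMr]
      calc C₁ ≤ M * (M : ℝ) ^ (-(1 / 2) * s) * η := hl
        _ ≤ M * ℓ ^ s * η :=
            mul_le_mul_of_nonneg_right (mul_le_mul_of_nonneg_left e1 hMr.le) hη.le
        _ = _ := by ring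
    linarith
  · have hFc : Continuous (bumpAverage τ M) := (contDiff_bumpAverage τ M).continuous
    have hG0 : 0 ≤ ∫ t in x..y, G t :=
      intervalIntegral.integral_nonneg hxy.le fun t _ => hG.nonneg t
    have h3 : ∫ t in x..y, G t * bumpAverage τ M t ≤ B * ∫ t in x..y, bumpAverage τ M t := by
      rw [← intervalIntegral.integral_const_mul]
      refine intervalIntegral.integral_mono_on hxy.le
        ((hG.continuous.mul hFc).intervalIntegrable _ _)
        ((continuous_const.mul hFc).intervalIntegrable _ _) fun t _ => ?_
      exact mul_le_mul_of_nonneg_right (hB t) (bumpAverage_nonneg τ hM t)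
    have h4 := h2 M hM2 hcard x y hxy hxy1
    have h5 : ℓ ^ (2 / τ) ≤ (M : ℝ) ^ (-κ) * ℓ ^ s := by
      have e1 := Real.rpow_le_rpow hℓ0.le h (show 0 ≤ 2 / τ - s by linarith)
      rw [← Real.rpow_mul hMr.le] at e1
      calc ℓ ^ (2 / τ) = ℓ ^ (2 / τ - s) * ℓ ^ s := by
            rw [← Real.rpow_add hℓ0]; congr 1; ring
        _ ≤ (M : ℝ) ^ (-(1 / 2) * (2 / τ - s)) * ℓ ^ s :=
            mul_le_mul_of_nonneg_right e1 (by positivity)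
        _ = _ := by rw [hκ]; congr 2; ring
    have hlog0 : 0 ≤ Real.log M := Real.log_nonneg (by exact_mod_cast hM)
    have hMκ : (M : ℝ) ^ κ * (M : ℝ) ^ (-κ) = 1 := by
      rw [← Real.rpow_add hMr]; simp
    calc _ ≤ B * ∫ t in x..y, bumpAverage τ M t := h3
      _ ≤ B * (C₂ * Real.log M * ℓ ^ (2 / τ)) := mul_le_mul_of_nonneg_left h4 (by linarith)
      _ ≤ B * (C₂ * (η / (B * C₂) * (M : ℝ) ^ κ) * ((M : ℝ) ^ (-κ) * ℓ ^ s)) := by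
          refine mul_le_mul_of_nonneg_left ?_ (by linarith)
          exact mul_le_mul (mul_le_mul_of_nonneg_left hsm hC₂.le) h5 (by positivity)
            (by positivity)
      _ = η * ((M : ℝ) ^ κ * (M : ℝ) ^ (-κ)) * ℓ ^ s := by field_simp
      _ = η * ℓ ^ s := by rw [hMκ, mul_one]
      _ ≤ _ := by linarith

/-! ### One step of the construction -/

/-- The points within `q ^ (-τ)` of a fraction with denominator `q ≥ j`. -/
def nearRational (τ : ℝ) (j : ℕ) : Set ℝ :=
  {x | ∃ q : ℕ, j ≤ q ∧ 0 < q ∧ ∃ r : ℤ, |x - r / q| ≤ (q : ℝ) ^ (-τ)}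

/-- The width was chosen from the largest denominator: `q ≤ 4M` gives `(4M) ^ (1 - τ) ≤ q ^ (1 -
τ)`, and division by `q` gives `q ^ (-τ)`. -/
theorem tsupport_bumpAverage_subset {τ : ℝ} (hτ : 1 ≤ τ) {M : ℕ} (hM : 0 < M) :
    tsupport (bumpAverage τ M) ⊆ nearRational τ M := by
  set ε := bumpWidth τ M with hε
  have hε0 : 0 < ε := bumpWidth_pos τ hM
  have hsub : tsupport (bumpAverage τ M) ⊆
      ⋃ q ∈ primeBlock M, ⋃ r ∈ Finset.Ico 1 q, {x : ℝ | |q * x - r| ≤ ε} := by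
    refine closure_minimal (fun x hx => ?_) ?_
    · by_contra hne
      apply hx
      simp only [Set.mem_iUnion, not_exists, Set.mem_ofPred_eq, not_le] at hne
      unfold bumpAverage bumpRow
      rw [Finset.sum_eq_zero, mul_zero]
      intro q hq
      refine Finset.sum_eq_zero fun r hr => scaledBump_eq_zero hε0 (hne q hq r hr).le
    · refine isClosed_biUnion_finset fun q _ => isClosed_biUnion_finset fun r _ => ?_
      exact isClosed_le (by fun_prop) continuous_const
  intro x hx
  have := hsub hx
  simp only [Set.mem_iUnion] at this
  obtain ⟨q, hq, r, -, h⟩ := this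
  obtain ⟨⟨h1, h2⟩, h3⟩ := mem_primeBlock.1 hq
  have hq0 : (0 : ℝ) < q := by exact_mod_cast h3.pos
  refine ⟨q, h1.le, h3.pos, r, ?_⟩
  have e1 : x - (r : ℤ) / (q : ℝ) = (q * x - r) / q := by push_cast; field_simp
  rw [e1, abs_div, abs_of_pos hq0, div_le_iff₀ hq0]
  refine le_trans h ?_
  calc ε ≤ (q : ℝ) ^ (1 - τ) :=
        Real.rpow_le_rpow_of_nonpos hq0 (by exact_mod_cast h2) (by linarith)
    _ = (q : ℝ) ^ (-τ) * q := by
        rw [show 1 - τ = -τ + 1 by ring, Real.rpow_add hq0, Real.rpow_one]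

theorem exists_refinement {G : ℝ → ℝ} (hG : IsSmoothDensity G) {τ s η : ℝ}
    (hτ : 2 ≤ τ) (hs0 : 0 < s) (hs : s < 2 / τ) (hη : 0 < η) (j : ℕ) :
    ∃ G' : ℝ → ℝ, IsSmoothDensity G' ∧ tsupport G' ⊆ tsupport G ∧
      tsupport G' ⊆ nearRational τ j ∧
      (∀ ξ, ‖densityFourier G' volume ξ - densityFourier G volume ξ‖ ≤ η * decayWeight τ ξ) ∧
      ∀ x y : ℝ, x < y → y - x ≤ 1 →
        ∫ t in x..y, G' t ≤ (∫ t in x..y, G t) + η * (y - x) ^ s := by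
  obtain ⟨M, h1, h2, h3, h4⟩ :=
    ((eventually_norm_densityFourier_mul_bumpAverage_sub_le hG (show 1 ≤ τ by linarith) hη).and
      ((eventually_integral_mul_bumpAverage_le hG hτ hs0 hs hη).and
      ((eventually_ge_atTop j).and (eventually_gt_atTop 0)))).exists
  refine ⟨fun x => G x * bumpAverage τ M x,
    hG.mul (contDiff_bumpAverage τ M) (bumpAverage_nonneg τ h4),
    tsupport_mul_subset_left, ?_, h1, h2⟩
  intro x hx
  obtain ⟨q, hq, hq0, r, hr⟩ := tsupport_bumpAverage_subset (show 1 ≤ τ by linarith) h4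
    (tsupport_mul_subset_right hx)
  exact ⟨q, h3.trans hq, hq0, r, hr⟩

/-! ### Passing to the limit -/

/-- Iterated refinement with errors `η / 2 ^ (n + 1)`, whose total stays below `η`. -/
theorem IsSmoothDensity.exists_refining_sequence {G : ℝ → ℝ} (hG : IsSmoothDensity G) {τ s η : ℝ}
    (hτ : 2 ≤ τ) (hs0 : 0 < s) (hs : s < 2 / τ) (hη : 0 < η) :
    ∃ u : ℕ → ℝ → ℝ, (∀ n, IsSmoothDensity (u n)) ∧ u 0 = G ∧
      (∀ n, tsupport (u (n + 1)) ⊆ tsupport (u n)) ∧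
      (∀ n, tsupport (u (n + 1)) ⊆ nearRational τ n) ∧
      (∀ n ξ, ‖densityFourier (u n) volume ξ - densityFourier G volume ξ‖ ≤
        η * decayWeight τ ξ) ∧
      ∀ n, ∀ x y : ℝ, x < y → y - x ≤ 1 →
        ∫ t in x..y, u n t ≤ (∫ t in x..y, G t) + η * (y - x) ^ s := by
  have hstep : ∀ (n : ℕ) (F : {F : ℝ → ℝ // IsSmoothDensity F}),
      ∃ F' : {F : ℝ → ℝ // IsSmoothDensity F}, tsupport F'.1 ⊆ tsupport F.1 ∧
      tsupport F'.1 ⊆ nearRational τ n ∧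
      (∀ ξ, ‖densityFourier F'.1 volume ξ - densityFourier F.1 volume ξ‖ ≤
        (η * (1 / 2) ^ (n + 1)) * decayWeight τ ξ) ∧
      ∀ x y : ℝ, x < y → y - x ≤ 1 →
        ∫ t in x..y, F'.1 t ≤ (∫ t in x..y, F.1 t) + (η * (1 / 2) ^ (n + 1)) * (y - x) ^ s := by
    intro n F
    obtain ⟨F', h⟩ := exists_refinement F.2 hτ hs0 hs
      (show 0 < η * (1 / 2) ^ (n + 1) by positivity) n
    exact ⟨⟨F', h.1⟩, h.2⟩
  choose next h1 h2 h3 h4 using hstep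
  set v : ℕ → {F : ℝ → ℝ // IsSmoothDensity F} := fun n => Nat.rec ⟨G, hG⟩ next n with hv
  have hpow : ∀ n : ℕ, (0 : ℝ) < (1 / 2) ^ n := fun n => by positivity
  refine ⟨fun n => (v n).1, fun n => (v n).2, rfl, fun n => h1 n (v n), fun n => h2 n (v n), ?_, ?_⟩
  · intro n ξ
    -- The induction needs the sharper factor `1 - (1/2) ^ n`, the sum of the errors made so far.
    have key : ‖densityFourier (v n).1 volume ξ - densityFourier G volume ξ‖ ≤
        η * (1 - (1 / 2) ^ n) * decayWeight τ ξ := by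
      induction n with
      | zero => simp [hv]
      | succ n ih =>
        have := norm_sub_le_norm_sub_add_norm_sub (densityFourier (v (n + 1)).1 volume ξ)
          (densityFourier (v n).1 volume ξ) (densityFourier G volume ξ)
        refine this.trans ((add_le_add (h3 n (v n) ξ) ih).trans (le_of_eq ?_))
        ring
    refine key.trans (mul_le_mul_of_nonneg_right ?_ (decayWeight_pos τ ξ).le)
    nlinarith [hpow n]
  · intro n x y hxy hxy1
    have key : ∫ t in x..y, (v n).1 t ≤
        (∫ t in x..y, G t) + η * (1 - (1 / 2) ^ n) * (y - x) ^ s := by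
      induction n with
      | zero => simp [hv]
      | succ n ih =>
        have := h4 n (v n) x y hxy hxy1
        refine this.trans ((add_le_add_left ih _).trans (le_of_eq ?_))
        ring
    refine key.trans (add_le_add_right (mul_le_mul_of_nonneg_right ?_ ?_) _)
    · nlinarith [hpow n]
    · exact Real.rpow_nonneg (by linarith) _

/-- The finite measure with a given smooth density. -/
noncomputable def densityMeasure (G : ℝ → ℝ) : Measure ℝ :=
  volume.withDensity fun x => ENNReal.ofReal (G x)

namespace IsSmoothDensity

variable {G : ℝ → ℝ}

theorem isFiniteMeasure_densityMeasure (hG : IsSmoothDensity G) :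
    IsFiniteMeasure (densityMeasure G) :=
  isFiniteMeasure_withDensity_ofReal hG.integrable.2

theorem integral_densityMeasure (hG : IsSmoothDensity G) {E : Type*} [NormedAddCommGroup E]
    [NormedSpace ℝ E] (f : ℝ → E) : ∫ x, f x ∂(densityMeasure G) = ∫ x, G x • f x := by
  unfold densityMeasure
  rw [integral_withDensity_eq_integral_toReal_smul
    (hG.continuous.measurable.ennreal_ofReal) (Filter.Eventually.of_forall fun x => by simp)]
  simp_rw [ENNReal.toReal_ofReal (hG.nonneg _)]

theorem measureFourier_densityMeasure (hG : IsSmoothDensity G) (ξ : ℝ) :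
    measureFourier (densityMeasure G) ξ = densityFourier G volume ξ := by
  unfold measureFourier densityFourier
  rw [hG.integral_densityMeasure]
  simp_rw [Complex.real_smul, mul_comm]

theorem densityMeasure_apply_eq_zero {t : Set ℝ} (ht : MeasurableSet t) (h : ∀ x ∈ t, G x = 0) :
    densityMeasure G t = 0 := by
  unfold densityMeasure
  rw [withDensity_apply _ ht]
  exact setLIntegral_eq_zero ht fun x hx => by simp [h x hx]

theorem densityMeasure_univ (hG : IsSmoothDensity G) :
    densityMeasure G Set.univ = ENNReal.ofReal (∫ x in (0 : ℝ)..1, G x) := by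
  unfold densityMeasure
  rw [withDensity_apply _ MeasurableSet.univ, Measure.restrict_univ,
    ← ofReal_integral_eq_lintegral_ofReal hG.integrable (Filter.Eventually.of_forall hG.nonneg),
    intervalIntegral.integral_of_le zero_le_one, setIntegral_eq_integral_of_forall_compl_eq_zero]
  intro x hx
  by_contra h
  have := hG.tsupport_subset (subset_tsupport G (Function.mem_support.2 h))
  exact hx ⟨this.1, this.2.le⟩

end IsSmoothDensity

/-- All bounds pass to a weak limit of the refined densities. No lower bound on the mass is listed,
since the Fourier estimate at `ξ = 0` contains it. The gap between `[a, b]` and `(x, y)` leaves room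
for a continuous cutoff. -/
theorem exists_measure_of_smoothDensity {G : ℝ → ℝ} (hG : IsSmoothDensity G) {τ s η : ℝ}
    (hτ : 2 ≤ τ) (hs0 : 0 < s) (hs : s < 2 / τ) (hη : 0 < η) :
    ∃ (ν : Measure ℝ) (S : Set ℝ), IsFiniteMeasure ν ∧ IsClosed S ∧ ν Sᶜ = 0 ∧ S ⊆ tsupport G ∧
      (∀ j, S ⊆ nearRational τ j) ∧
      (∀ ξ, ‖measureFourier ν ξ - densityFourier G volume ξ‖ ≤ η * decayWeight τ ξ) ∧
      ∀ x a b y : ℝ, x < a → a ≤ b → b < y → y - x ≤ 1 →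
        ν (Set.Icc a b) ≤ ENNReal.ofReal ((∫ t in x..y, G t) + η * (y - x) ^ s) := by
  obtain ⟨u, hu, hu0, hu1, hu2, hu3, hu4⟩ := hG.exists_refining_sequence hτ hs0 hs hη
  have hanti : ∀ m n, m ≤ n → tsupport (u n) ⊆ tsupport (u m) := fun m n hmn =>
    antitone_nat_of_succ_le (f := fun n => tsupport (u n)) hu1 hmn
  set ν : ℕ → FiniteMeasure ℝ := fun n =>
    ⟨densityMeasure (u n), (hu n).isFiniteMeasure_densityMeasure⟩ with hν
  set C : NNReal := Real.toNNReal ((∫ t in (0 : ℝ)..1, G t) + η) with hC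
  have hmass : ∀ n, (ν n).mass ≤ C := by
    intro n
    rw [← ENNReal.coe_le_coe, FiniteMeasure.ennreal_mass]
    change densityMeasure (u n) Set.univ ≤ ENNReal.ofReal _
    rw [(hu n).densityMeasure_univ]
    refine ENNReal.ofReal_le_ofReal ?_
    simpa using hu4 n 0 1 zero_lt_one (by simp)
  have hnull : ∀ m n, m ≤ n → ν n (tsupport (u m))ᶜ = 0 := by
    intro m n hmn
    rw [FiniteMeasure.null_iff_toMeasure_null]
    refine IsSmoothDensity.densityMeasure_apply_eq_zero
      (isClosed_tsupport _).measurableSet.compl fun x hx => ?_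
    exact image_eq_zero_of_notMem_tsupport fun h => hx (hanti m n hmn h)
  have hcomp : ∀ m, IsCompact {μ : FiniteMeasure ℝ | μ.mass ≤ C ∧ μ (tsupport (u m))ᶜ = 0} :=
    fun m => isCompact_setOfPred_finiteMeasure_le_of_isCompact C (hu m).hasCompactSupport.isCompact
  -- Measures of bounded mass on a fixed compact set form a weakly compact set, so the sequence
  -- converges along an ultrafilter and no subsequence has to be extracted.
  obtain ⟨ν', -, hlim⟩ := (hcomp 0).ultrafilter_le_nhds ((hyperfilter ℕ).map ν) (by
    rw [le_principal_iff, Ultrafilter.mem_coe, Ultrafilter.mem_map]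
    exact Filter.univ_mem' fun n => ⟨hmass n, hnull 0 n (Nat.zero_le n)⟩)
  have htend : Tendsto ν (hyperfilter ℕ : Filter ℕ) (nhds ν') := hlim
  refine ⟨ν', ⋂ n, tsupport (u n), inferInstance, isClosed_iInter fun n => isClosed_tsupport _,
    ?_, ?_, ?_, ?_, ?_⟩
  · rw [Set.compl_iInter, measure_iUnion_null_iff]
    intro m
    -- For each `m`, all but finitely many measures are carried by the `m`-th support. This
    -- condition is weakly closed, so the limit is carried by every support and hence by their
    -- intersection.
    have hev : ∀ᶠ n in (hyperfilter ℕ : Filter ℕ),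
        ν n ∈ {μ : FiniteMeasure ℝ | μ.mass ≤ C ∧ μ (tsupport (u m))ᶜ = 0} := by
      have : ∀ᶠ n in atTop, m ≤ n := eventually_ge_atTop m
      rw [← Nat.cofinite_eq_atTop] at this
      filter_upwards [hyperfilter_le_cofinite this] with n hn
      exact ⟨hmass n, hnull m n hn⟩
    have := (hcomp m).isClosed.mem_of_tendsto htend hev
    exact (FiniteMeasure.null_iff_toMeasure_null _ _).1 this.2
  · rw [← hu0]
    exact Set.iInter_subset _ 0
  · exact fun j => (Set.iInter_subset _ (j + 1)).trans (hu2 j)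
  · intro ξ
    set f : BoundedContinuousFunction ℝ ℂ := BoundedContinuousFunction.ofNormedAddCommGroup
      (fun x : ℝ => Complex.exp (-2 * Real.pi * Complex.I * x * ξ)) (by fun_prop) 1
      (fun x => (norm_exp_neg_two_pi_mul x ξ).le)
    have h1 := (FiniteMeasure.tendsto_iff_forall_integral_rclike_tendsto ℂ).1 htend f
    have h2 : Tendsto (fun n => measureFourier (densityMeasure (u n)) ξ)
        (hyperfilter ℕ : Filter ℕ) (nhds (measureFourier ν' ξ)) := h1
    refine le_of_tendsto (h2.sub_const (densityFourier G volume ξ)).norm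
      (Filter.Eventually.of_forall fun n => ?_)
    rw [(hu n).measureFourier_densityMeasure]
    exact hu3 n ξ
  · intro x a b y hxa hab hby hxy1
    have hxy : x < y := by linarith
    obtain ⟨f, hf0, hf1, hf⟩ := exists_continuous_zero_one_of_isClosed
      (isOpen_Ioo (a := x) (b := y)).isClosed_compl (isClosed_Icc (a := a) (b := b)) (by
        rw [Set.disjoint_compl_left_iff_subset]
        exact fun t ht => ⟨by linarith [ht.1], by linarith [ht.2]⟩)
    set g : BoundedContinuousFunction ℝ ℝ := BoundedContinuousFunction.ofNormedAddCommGroup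
      f f.continuous 1 (fun t => by
        rw [Real.norm_of_nonneg (hf t).1]; exact (hf t).2)
    have h1 := FiniteMeasure.tendsto_iff_forall_integral_tendsto.1 htend g
    have h2 : ∫ t, g t ∂(ν' : Measure ℝ) ≤ (∫ t in x..y, G t) + η * (y - x) ^ s := by
      refine le_of_tendsto h1 (Filter.Eventually.of_forall fun n => ?_)
      refine le_trans ?_ (hu4 n x y hxy hxy1)
      change ∫ t, f t ∂(densityMeasure (u n)) ≤ _
      rw [(hu n).integral_densityMeasure, intervalIntegral.integral_of_le hxy.le,
        ← integral_indicator measurableSet_Ioc]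
      refine integral_mono_of_nonneg
        (Filter.Eventually.of_forall fun t => mul_nonneg ((hu n).nonneg t) (hf t).1)
        ((hu n).integrable.indicator measurableSet_Ioc) (Filter.Eventually.of_forall fun t => ?_)
      by_cases ht : t ∈ Set.Ioc x y
      · simp only [Set.indicator_of_mem ht, smul_eq_mul]
        exact mul_le_of_le_one_right ((hu n).nonneg t) (hf t).2
      · have : f t = 0 := hf0 fun h => ht ⟨h.1, h.2.le⟩
        simp [this, Set.indicator_of_notMem ht]
    have h3 : (ν' : Measure ℝ).real (Set.Icc a b) ≤ ∫ t, g t ∂(ν' : Measure ℝ) := by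
      rw [← integral_indicator_one measurableSet_Icc]
      refine integral_mono_of_nonneg (Filter.Eventually.of_forall fun t =>
        Set.indicator_nonneg (fun _ _ => zero_le_one) t) (g.integrable _)
        (Filter.Eventually.of_forall fun t => ?_)
      by_cases ht : t ∈ Set.Icc a b
      · have : f t = 1 := hf1 ht
        rw [Set.indicator_of_mem ht]
        exact this.ge
      · rw [Set.indicator_of_notMem ht]
        exact (hf t).1
    rw [← ofReal_measureReal]
    exact ENNReal.ofReal_le_ofReal (h3.trans h2)

/-! ### Densities concentrated near short arithmetic progressions -/

/-- The probability density that consists of bumps of width `N ^ (-τ)` at `r / N`, `1 ≤ r ≤ K`. -/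
noncomputable def progressionDensity (τ : ℝ) (N K : ℕ) (x : ℝ) : ℝ :=
  (N / K : ℝ) * ∑ r ∈ Finset.Ico 1 (K + 1), scaledBump ((N : ℝ) ^ (1 - τ)) (N * x - r)

/-- The `N ^ (-τ)`-neighbourhood of the progression `r / N`, `1 ≤ r ≤ K`. -/
def progressionNhd (τ : ℝ) (N K : ℕ) : Set ℝ :=
  {x | ∃ r : ℕ, 1 ≤ r ∧ r ≤ K ∧ |N * x - r| ≤ (N : ℝ) ^ (1 - τ)}

theorem rpow_one_sub_le_half {τ : ℝ} (hτ : 2 ≤ τ) {N : ℕ} (hN : 2 ≤ N) :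
    (N : ℝ) ^ (1 - τ) ≤ 1 / 2 := by
  have hN' : (2 : ℝ) ≤ N := by exact_mod_cast hN
  calc (N : ℝ) ^ (1 - τ) ≤ (N : ℝ) ^ (-1 : ℝ) :=
        Real.rpow_le_rpow_of_exponent_le (by linarith) (by linarith)
    _ = (N : ℝ)⁻¹ := Real.rpow_neg_one _
    _ ≤ 1 / 2 := by rw [one_div]; exact inv_anti₀ (by norm_num) hN'

theorem tsupport_progressionDensity_subset (τ : ℝ) {N : ℕ} (hN : 0 < N) (K : ℕ) :
    tsupport (progressionDensity τ N K) ⊆ progressionNhd τ N K := by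
  have hε : 0 < (N : ℝ) ^ (1 - τ) := by positivity
  have hsub : tsupport (progressionDensity τ N K) ⊆
      ⋃ r ∈ Finset.Ico 1 (K + 1), {x : ℝ | |N * x - r| ≤ (N : ℝ) ^ (1 - τ)} := by
    refine closure_minimal (fun x hx => ?_) ?_
    · by_contra hne
      apply hx
      simp only [Set.mem_iUnion, not_exists, Set.mem_ofPred_eq, not_le] at hne
      unfold progressionDensity
      rw [Finset.sum_eq_zero, mul_zero]
      exact fun r hr => scaledBump_eq_zero hε (hne r hr).le
    · refine isClosed_biUnion_finset fun r _ => ?_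
      exact isClosed_le (by fun_prop) continuous_const
  intro x hx
  have := hsub hx
  simp only [Set.mem_iUnion] at this
  obtain ⟨r, hr, h⟩ := this
  rw [Finset.mem_Ico] at hr
  exact ⟨r, hr.1, by omega, h⟩

theorem progressionNhd_subset {τ : ℝ} (hτ : 2 ≤ τ) {N : ℕ} (hN : 2 ≤ N) (K : ℕ) :
    progressionNhd τ N K ⊆ Set.Ioo 0 ((K + 1) / N) := by
  rintro x ⟨r, hr1, hrK, h⟩
  have hN' : (0 : ℝ) < N := by exact_mod_cast (by omega : 0 < N)
  have h1 := abs_le.1 (h.trans (rpow_one_sub_le_half hτ hN))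
  have h2 : (1 : ℝ) ≤ r := by exact_mod_cast hr1
  have h3 : (r : ℝ) ≤ K := by exact_mod_cast hrK
  constructor
  · by_contra hx
    nlinarith
  · rw [lt_div_iff₀ hN']
    linarith

theorem isSmoothDensity_progressionDensity {τ : ℝ} (hτ : 2 ≤ τ) {N K : ℕ} (hN : 2 ≤ N)
    (hKN : K + 1 ≤ N) : IsSmoothDensity (progressionDensity τ N K) where
  contDiff := by
    unfold progressionDensity
    refine contDiff_const.mul (ContDiff.sum fun r _ => ?_)
    exact (contDiff_scaledBump _).comp ((contDiff_const.mul contDiff_id).sub contDiff_const)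
  nonneg x := by
    have : 0 < (N : ℝ) ^ (1 - τ) := by positivity
    exact mul_nonneg (by positivity) (Finset.sum_nonneg fun r _ => scaledBump_nonneg this _)
  tsupport_subset := by
    refine (tsupport_progressionDensity_subset τ (by omega) K).trans
      ((progressionNhd_subset hτ hN K).trans (Set.Ioo_subset_Ioo_right ?_))
    have hN' : (0 : ℝ) < N := by exact_mod_cast (by omega : 0 < N)
    rw [div_le_one hN']
    exact_mod_cast hKN

/-- All bumps are translates of one, so the transform factors into an exponential sum and the
transform of a single bump of width `N ^ (-τ)`. -/
theorem densityFourier_progressionDensity (τ : ℝ) {N : ℕ} (hN : 0 < N) (K : ℕ) (ξ : ℝ) :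
    densityFourier (progressionDensity τ N K) volume ξ = (K : ℂ)⁻¹ *
      (∑ r ∈ Finset.Ico 1 (K + 1), Complex.exp (-2 * Real.pi * Complex.I * (r / N : ℝ) * ξ)) *
        densityFourier unitBump volume ((N : ℝ) ^ (-τ) * ξ) := by
  have hN' : (0 : ℝ) < N := by exact_mod_cast hN
  have hNC : (N : ℂ) ≠ 0 := by exact_mod_cast hN.ne'
  have hε : 0 < (N : ℝ) ^ (1 - τ) := by positivity
  have hδ : (N : ℝ) ^ (1 - τ) / N = (N : ℝ) ^ (-τ) := by
    rw [div_eq_iff hN'.ne', show 1 - τ = -τ + 1 by ring, Real.rpow_add hN', Real.rpow_one]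
  have h := fun r : ℕ => integral_exp_mul_scaledBump hε hN' r ξ
  simp only [hδ, Complex.ofReal_natCast] at h
  calc _ = ∫ x : ℝ, ((N : ℂ) / K) * ∑ r ∈ Finset.Ico 1 (K + 1),
        (Complex.exp (-2 * Real.pi * Complex.I * x * ξ) *
          (scaledBump ((N : ℝ) ^ (1 - τ)) (N * x - r) : ℂ)) := by
        unfold densityFourier
        congr 1
        ext x
        unfold progressionDensity
        push_cast
        rw [← Finset.mul_sum]
        ring
    _ = ((N : ℂ) / K) * ∑ r ∈ Finset.Ico 1 (K + 1),
        ((N : ℂ)⁻¹ * (Complex.exp (-2 * Real.pi * Complex.I * (r / N : ℝ) * ξ) *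
        densityFourier unitBump volume ((N : ℝ) ^ (-τ) * ξ))) := by
        rw [integral_const_mul, integral_finsetSum]
        · congr 1
          refine Finset.sum_congr rfl fun r _ => ?_
          exact h r
        · intro r _
          refine (integrable_scaledBump_affine hε hN' r).ofReal.bdd_mul (c := 1) (by fun_prop) ?_
          exact Filter.Eventually.of_forall fun x => (norm_exp_neg_two_pi_mul x ξ).le
    _ = _ := by
        rw [← Finset.mul_sum, ← Finset.sum_mul, ← mul_assoc, ← mul_assoc, div_mul_eq_mul_div,
          mul_inv_cancel₀ hNC, one_div]

theorem integral_progressionDensity_eq_one (τ : ℝ) {N K : ℕ} (hN : 0 < N) (hK : 0 < K) :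
    densityFourier (progressionDensity τ N K) volume 0 = 1 := by
  have hKC : (K : ℂ) ≠ 0 := by exact_mod_cast hK.ne'
  rw [densityFourier_progressionDensity τ hN]
  simp [densityFourier_unitBump_zero, hKC]

/-- The normalized exponential sum is bounded by 1. For the bump, decay of order 1 is weakened to
order `1/τ`, so that rescaling by `N ^ (-τ)` costs exactly one factor `N`. -/
theorem exists_densityFourier_progressionDensity_le {τ : ℝ} (hτ : 2 ≤ τ) :
    ∃ C : ℝ, 0 < C ∧ ∀ N K : ℕ, 0 < N → 0 < K → ∀ ξ,
      ‖densityFourier (progressionDensity τ N K) volume ξ‖ ≤ C * N * decayWeight τ ξ := by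
  obtain ⟨A, hA0, hA⟩ :=
    exists_densityFourier_decay contDiff_unitBump hasCompactSupport_unitBump 1
  refine ⟨A, hA0, fun N K hN hK ξ => ?_⟩
  have hN' : (0 : ℝ) < N := by exact_mod_cast hN
  have hN1 : (1 : ℝ) ≤ N := by exact_mod_cast hN
  have hK' : (0 : ℝ) < K := by exact_mod_cast hK
  have hτ0 : 0 < τ := by linarith
  have h1 : ‖densityFourier (progressionDensity τ N K) volume ξ‖ ≤
      ‖densityFourier unitBump volume ((N : ℝ) ^ (-τ) * ξ)‖ := by
    rw [densityFourier_progressionDensity τ hN, norm_mul, norm_mul, norm_inv, Complex.norm_natCast]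
    refine mul_le_of_le_one_left (norm_nonneg _) ?_
    rw [inv_mul_le_iff₀ hK', mul_one]
    refine (norm_sum_le _ _).trans (le_of_eq ?_)
    rw [Finset.sum_congr rfl fun r _ => norm_exp_neg_two_pi_mul _ _]
    simp
  refine h1.trans ((hA _).trans ?_)
  have hpos : 0 < (N : ℝ) ^ (-τ) := by positivity
  have hle1 : (N : ℝ) ^ (-τ) ≤ 1 := Real.rpow_le_one_of_one_le_of_nonpos hN1 (by linarith)
  have e1 : (N : ℝ) ^ (-τ) * (1 + |ξ|) ≤ 1 + |(N : ℝ) ^ (-τ) * ξ| := by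
    rw [abs_mul, abs_of_pos hpos]
    linarith
  have e2 : (1 + |(N : ℝ) ^ (-τ) * ξ|)⁻¹ ≤ N * (1 + |ξ|) ^ (-(1 / τ)) := by
    calc (1 + |(N : ℝ) ^ (-τ) * ξ|)⁻¹ = (1 + |(N : ℝ) ^ (-τ) * ξ|) ^ (-1 : ℝ) :=
          (Real.rpow_neg_one _).symm
      _ ≤ (1 + |(N : ℝ) ^ (-τ) * ξ|) ^ (-(1 / τ)) := by
          refine Real.rpow_le_rpow_of_exponent_le
            (by linarith [abs_nonneg ((N : ℝ) ^ (-τ) * ξ)]) ?_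
          rw [neg_le_neg_iff, div_le_one hτ0]
          linarith
      _ ≤ ((N : ℝ) ^ (-τ) * (1 + |ξ|)) ^ (-(1 / τ)) :=
          Real.rpow_le_rpow_of_nonpos (by positivity) e1 (by rw [neg_nonpos]; positivity)
      _ = N * (1 + |ξ|) ^ (-(1 / τ)) := by
          rw [Real.mul_rpow hpos.le (by positivity), ← Real.rpow_mul hN'.le, neg_mul_neg,
            mul_one_div_cancel hτ0.ne', Real.rpow_one]
  rw [pow_one, div_eq_mul_inv, mul_assoc]
  refine mul_le_mul_of_nonneg_left (e2.trans ?_) hA0.le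
  exact mul_le_mul_of_nonneg_left (rpow_le_decayWeight τ ξ) hN'.le

/-- The extremal length is the bump width `N ^ (-τ)`: a bump of the normalized density has mass `1 /
K ≈ N ^ (-1 - β)`, which is `N * (N ^ (-τ)) ^ s`. -/
theorem exists_integral_progressionDensity_le {τ β : ℝ} (hτ : 2 ≤ τ) (hβ : -1 < β) (hβ0 : β < 0) :
    ∃ C : ℝ, 0 < C ∧ ∀ N K : ℕ, 2 ≤ N → (N : ℝ) ^ (1 + β) ≤ 2 * K →
      ∀ x y : ℝ, x < y → y - x ≤ 1 →
        ∫ t in x..y, progressionDensity τ N K t ≤ C * N * (y - x) ^ ((2 + β) / τ) := by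
  obtain ⟨A, hA1, hA⟩ := exists_unitBump_le
  refine ⟨2 + 8 * A, by positivity, fun N K hN hK x y hxy hxy1 => ?_⟩
  have hτ0 : 0 < τ := by linarith
  have hN' : (0 : ℝ) < N := by exact_mod_cast (by omega : 0 < N)
  have hN1 : (1 : ℝ) ≤ N := by exact_mod_cast (by omega : 1 ≤ N)
  set s := (2 + β) / τ with hs
  have hs0 : 0 < s := div_pos (by linarith) hτ0
  have hs1 : s ≤ 1 := by rw [hs, div_le_one hτ0]; linarith
  set ℓ := y - x with hℓ
  have hℓ0 : 0 < ℓ := by linarith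
  set ε := (N : ℝ) ^ (1 - τ) with hεdef
  have hε : 0 < ε := by positivity
  have hε1 : ε ≤ 1 / 2 := rpow_one_sub_le_half hτ hN
  have hK' : (0 : ℝ) < K := by
    have : 0 < (N : ℝ) ^ (1 + β) := by positivity
    linarith
  set m := min (1 / (N : ℝ)) (A / ε * ℓ) with hm
  have hm0 : 0 ≤ m := by positivity
  have hsum : ∑ r ∈ Finset.Ico 1 (K + 1), ∫ t in x..y, scaledBump ε (N * t - r) ≤
      ((y - x + 2 * (ε / N)) / (1 / N) + 2) * m := by
    refine sum_integral_le_of_separated (Finset.Ico 1 (K + 1)) (fun r : ℕ => (r : ℝ) / N)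
      (fun r t => scaledBump ε (N * t - r)) (by positivity) (by positivity) hm0 hxy.le ?_ ?_ ?_
    · intro r _ r' _ hne
      rw [← sub_div, abs_div, abs_of_pos hN']
      refine div_le_div_of_nonneg_right ?_ hN'.le
      have : (r : ℤ) - r' ≠ 0 := sub_ne_zero.2 (by exact_mod_cast hne)
      exact_mod_cast Int.one_le_abs this
    · intro r _
      refine le_min ?_ (intervalIntegral_scaledBump_le_mul hA hε hxy.le)
      rw [one_div]
      exact intervalIntegral_scaledBump_le_inv hε hN' hxy.le
    · intro r _ h
      exact intervalIntegral_scaledBump_eq_zero hε hN' hxy.le h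
  have hcount : ((y - x + 2 * (ε / N)) / (1 / N) + 2) * m ≤ ℓ + 4 * m := by
    have e1 : (y - x + 2 * (ε / N)) / (1 / N) + 2 = N * ℓ + 2 * ε + 2 := by
      rw [← hℓ]; field_simp
    rw [e1]
    have e2 : N * m ≤ 1 := by
      have : m ≤ 1 / N := min_le_left _ _
      rw [le_div_iff₀ hN'] at this
      linarith
    nlinarith
  have hNτ : (N : ℝ) ^ (2 + β) = ((N : ℝ) ^ τ) ^ s := by
    rw [← Real.rpow_mul hN'.le, hs, mul_div_cancel₀ _ hτ0.ne']
  -- The cases are `ℓ` above or below the bump width. In the second, `s ≤ 1` lets the linear bound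
  -- be weakened to the power `s`.
  have hm1 : m ≤ A * (N : ℝ)⁻¹ * (ℓ ^ s * (N : ℝ) ^ (2 + β)) := by
    rw [hNτ, ← Real.mul_rpow hℓ0.le (by positivity)]
    have hp : 0 < ℓ * (N : ℝ) ^ τ := by positivity
    rcases le_total 1 (ℓ * (N : ℝ) ^ τ) with h | h
    · have h1 : 1 ≤ (ℓ * (N : ℝ) ^ τ) ^ s := Real.one_le_rpow h hs0.le
      calc m ≤ 1 / N := min_le_left _ _
        _ = 1 * (N : ℝ)⁻¹ * 1 := by rw [one_mul, mul_one, one_div]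
        _ ≤ _ := by gcongr
    · have h1 : ℓ * (N : ℝ) ^ τ ≤ (ℓ * (N : ℝ) ^ τ) ^ s := by
        conv_lhs => rw [← Real.rpow_one (ℓ * (N : ℝ) ^ τ)]
        exact Real.rpow_le_rpow_of_exponent_ge hp h hs1
      have h2 : ε = N * ((N : ℝ) ^ τ)⁻¹ := by
        rw [hεdef, sub_eq_add_neg, Real.rpow_add hN', Real.rpow_one, Real.rpow_neg hN'.le]
      calc m ≤ A / ε * ℓ := min_le_right _ _
        _ = A * (N : ℝ)⁻¹ * (ℓ * (N : ℝ) ^ τ) := by rw [h2]; field_simp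
        _ ≤ _ := by gcongr
  have hNK : (N : ℝ) / K ≤ 2 * (N : ℝ) ^ (-β) := by
    rw [div_le_iff₀ hK']
    have e : (N : ℝ) = (N : ℝ) ^ (-β) * (N : ℝ) ^ (1 + β) := by
      rw [← Real.rpow_add hN']; simp
    calc (N : ℝ) = (N : ℝ) ^ (-β) * (N : ℝ) ^ (1 + β) := e
      _ ≤ (N : ℝ) ^ (-β) * (2 * K) := mul_le_mul_of_nonneg_left hK (by positivity)
      _ = _ := by ring
  have hint : ∫ t in x..y, progressionDensity τ N K t =
      (N / K : ℝ) * ∑ r ∈ Finset.Ico 1 (K + 1), ∫ t in x..y, scaledBump ε (N * t - r) := by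
    unfold progressionDensity
    rw [intervalIntegral.integral_const_mul, intervalIntegral.integral_finsetSum]
    exact fun r _ => (continuous_scaledBump_affine _ _ _).intervalIntegrable _ _
  have hℓs : ℓ ≤ ℓ ^ s := by
    conv_lhs => rw [← Real.rpow_one ℓ]
    exact Real.rpow_le_rpow_of_exponent_ge hℓ0 hxy1 hs1
  have hNβ : (N : ℝ) ^ (-β) ≤ N := by
    calc (N : ℝ) ^ (-β) ≤ (N : ℝ) ^ (1 : ℝ) :=
          Real.rpow_le_rpow_of_exponent_le hN1 (by linarith)
      _ = N := Real.rpow_one _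
  have hNN : (N : ℝ) ^ (-β) * (N : ℝ) ^ (2 + β) = N * N := by
    rw [← Real.rpow_add hN', show -β + (2 + β) = 2 by ring, Real.rpow_two, sq]
  rw [hint]
  calc _ ≤ 2 * (N : ℝ) ^ (-β) * (ℓ + 4 * m) :=
        mul_le_mul hNK (hsum.trans hcount)
          (Finset.sum_nonneg fun r _ => intervalIntegral_scaledBump_nonneg hε hxy.le)
          (by positivity)
    _ ≤ 2 * (N : ℝ) ^ (-β) * (ℓ ^ s + 4 * (A * (N : ℝ)⁻¹ * (ℓ ^ s * (N : ℝ) ^ (2 + β)))) := by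
        refine mul_le_mul_of_nonneg_left ?_ (by positivity)
        linarith
    _ = 2 * (N : ℝ) ^ (-β) * ℓ ^ s + 8 * A * (N : ℝ)⁻¹ *
          ((N : ℝ) ^ (-β) * (N : ℝ) ^ (2 + β)) * ℓ ^ s := by ring
    _ = 2 * (N : ℝ) ^ (-β) * ℓ ^ s + 8 * A * N * ℓ ^ s := by
        rw [hNN]; field_simp
    _ ≤ 2 * N * ℓ ^ s + 8 * A * N * ℓ ^ s := by
        have : 0 ≤ ℓ ^ s := by positivity
        nlinarith
    _ = _ := by ring

/-! ### Large Fourier coefficients -/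

/-- If `ξ` is almost a multiple of `N` and not too large, then the Fourier transform at `ξ` of a
measure carried by `progressionNhd` has no cancellation. -/
theorem half_mass_le_norm_measureFourier {τ : ℝ} {N K : ℕ} (hN : 0 < N) (hK : 0 < K)
    {ν : Measure ℝ} [IsFiniteMeasure ν] (hν : ∀ᵐ x ∂ν, x ∈ progressionNhd τ N K) {ξ : ℝ} {n : ℕ}
    (h1 : N * n ≤ ξ) (h2 : ξ ≤ N * n + N / (16 * K)) (h3 : ξ ≤ (N : ℝ) ^ τ / 16) :
    ν.real Set.univ / 2 ≤ ‖measureFourier ν ξ‖ := by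
  have hN' : (0 : ℝ) < N := by exact_mod_cast hN
  have hK' : (0 : ℝ) < K := by exact_mod_cast hK
  have hξ0 : 0 ≤ ξ := le_trans (by positivity) h1
  have hint : Integrable (fun x : ℝ => Complex.exp (-2 * Real.pi * Complex.I * x * ξ)) ν := by
    refine Integrable.of_bound (by fun_prop) 1 ?_
    exact Filter.Eventually.of_forall fun x => (norm_exp_neg_two_pi_mul x ξ).le
  have hre : (measureFourier ν ξ).re =
      ∫ x : ℝ, (Complex.exp (-2 * Real.pi * Complex.I * x * ξ)).re ∂ν := by
    unfold measureFourier
    exact (integral_re hint).symm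
  have hcos : ∀ᵐ x : ℝ ∂ν, 1 / 2 ≤ (Complex.exp (-2 * Real.pi * Complex.I * x * ξ)).re := by
    filter_upwards [hν] with x hx
    obtain ⟨r, hr1, hrK, hr⟩ := hx
    rw [show (-2 * Real.pi * Complex.I * x * ξ : ℂ) =
      ((-(2 * Real.pi * (x * ξ)) : ℝ) : ℂ) * Complex.I by push_cast; ring,
      Complex.exp_ofReal_mul_I_re, Real.cos_neg]
    set t := ξ - N * n with ht
    have ht0 : 0 ≤ t := by linarith
    -- With `ξ = N n + t`, the phase `x ξ` is the integer `r n` plus `w`. The first summand of `w`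
    -- is small because `t` is, the second because `x` is close to `r / N`. Then `|2 π w| ≤ 1` and
    -- the cosine is at least 1/2.
    set w := r * t / N + (N * x - r) * ξ / N with hw
    have hxξ : x * ξ = (r * n : ℕ) + w := by
      rw [hw, ht]
      push_cast
      field_simp
      ring
    have hrK' : (r : ℝ) ≤ K := by exact_mod_cast hrK
    have hw1 : |r * t / N| ≤ 1 / 16 := by
      rw [abs_of_nonneg (by positivity), div_le_iff₀ hN']
      have h4 : t ≤ N / (16 * K) := by linarith
      rw [le_div_iff₀ (by positivity)] at h4
      nlinarith
    have hw2 : |(N * x - r) * ξ / N| ≤ 1 / 16 := by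
      rw [abs_div, abs_mul, abs_of_nonneg hξ0, abs_of_pos hN', div_le_iff₀ hN']
      have e : (N : ℝ) ^ (1 - τ) * (N : ℝ) ^ τ = N := by
        rw [← Real.rpow_add hN']; simp
      calc |N * x - r| * ξ ≤ (N : ℝ) ^ (1 - τ) * ((N : ℝ) ^ τ / 16) :=
            mul_le_mul hr h3 hξ0 (by positivity)
        _ = 1 / 16 * ((N : ℝ) ^ (1 - τ) * (N : ℝ) ^ τ) := by ring
        _ = _ := by rw [e]
    have hwb : |w| ≤ 1 / 8 := (abs_add_le _ _).trans (by linarith)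
    have e1 : 2 * Real.pi * (x * ξ) = 2 * Real.pi * w + (r * n : ℕ) * (2 * Real.pi) := by
      rw [hxξ]; ring
    rw [e1, Real.cos_add_nat_mul_two_pi]
    have hpi : Real.pi < 4 := Real.pi_lt_four
    have e2 : |2 * Real.pi * w| ≤ 1 := by
      rw [abs_mul, abs_of_pos (by positivity)]
      nlinarith [Real.pi_pos, abs_nonneg w]
    have e3 := Real.one_sub_sq_div_two_le_cos (x := 2 * Real.pi * w)
    have e4 : (2 * Real.pi * w) ^ 2 ≤ 1 := by
      rw [← sq_abs]
      exact pow_le_one₀ (abs_nonneg _) e2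
    linarith
  calc ν.real Set.univ / 2 = ∫ _, (1 / 2 : ℝ) ∂ν := by
        rw [integral_const, smul_eq_mul]; ring
    _ ≤ ∫ x : ℝ, (Complex.exp (-2 * Real.pi * Complex.I * x * ξ)).re ∂ν :=
        integral_mono_ae (integrable_const _) hint.re hcos
    _ = (measureFourier ν ξ).re := hre.symm
    _ ≤ _ := Complex.re_le_norm _

theorem volume_almost_multiples {N K L : ℕ} (hN : 0 < N) (hK : 0 < K) :
    volume (⋃ n ∈ Finset.range L, Set.Icc (N * n : ℝ) (N * n + N / (16 * K))) =
      ENNReal.ofReal (L * (N / (16 * K))) := by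
  have hN' : (0 : ℝ) < N := by exact_mod_cast hN
  have hK' : (1 : ℝ) ≤ K := by exact_mod_cast hK
  have hlt : (N : ℝ) / (16 * K) < N := by
    rw [div_lt_iff₀ (by positivity)]
    nlinarith
  rw [measure_biUnion_finset _ fun _ _ => measurableSet_Icc]
  · simp only [Real.volume_Icc, add_sub_cancel_left, Finset.sum_const, Finset.card_range]
    rw [nsmul_eq_mul, ENNReal.ofReal_mul (by positivity), ENNReal.ofReal_natCast]
  · have key : ∀ m n : ℕ, m < n → Disjoint (Set.Icc (N * m : ℝ) (N * m + N / (16 * K)))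
        (Set.Icc (N * n : ℝ) (N * n + N / (16 * K))) := by
      intro m n hmn
      rw [Set.disjoint_left]
      intro x hx hx'
      have : (m : ℝ) + 1 ≤ n := by exact_mod_cast hmn
      have h1 := hx.2
      have h2 := hx'.1
      nlinarith
    intro m _ n _ hmn
    rcases lt_or_gt_of_ne hmn with h | h
    · exact key m n h
    · exact (key n m h).symm

/-! ### The well-approximable set -/

/-- Approximations with denominators at least `j`, for every `j`, have unbounded first coordinates,
hence form an infinite set of pairs. -/
theorem mem_alphaWellApproximable_of_nearRational {α x : ℝ}
    (hx : ∀ j, x ∈ nearRational (2 + α) j) : x ∈ alphaWellApproximable α := by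
  change Set.Infinite _
  refine Set.Infinite.of_image Prod.fst (Set.infinite_of_not_bddAbove ?_)
  rintro ⟨b, hb⟩
  obtain ⟨q, hq, hq0, r, hr⟩ := hx (b.toNat + 1)
  have h1 : (q : ℤ) ∈ Prod.fst '' {z : ℤ × ℤ | z.1 ≠ 0 ∧
      |x - (z.2 : ℝ) / (z.1 : ℝ)| ≤ |(z.1 : ℝ)| ^ (-(2 + α))} := by
    refine ⟨((q : ℤ), r), ⟨by simpa using hq0.ne', ?_⟩, rfl⟩
    simpa using hr
  have := hb h1
  omega

/-- Needed because the blocks accumulate at `0`, which may belong to the support of their sum. -/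
theorem zero_mem_alphaWellApproximable (α : ℝ) : (0 : ℝ) ∈ alphaWellApproximable α := by
  refine mem_alphaWellApproximable_of_nearRational fun j => ⟨j + 1, by omega, by omega, 0, ?_⟩
  simp only [Int.cast_zero, zero_div, sub_zero, abs_zero]
  positivity

/-! ### The building blocks of the measure -/

theorem eventually_progression_parameters {β : ℝ} (hβ : -1 < β) (hβ0 : β < 0) :
    ∀ᶠ N : ℕ in atTop, 32 ≤ N ∧ 2 ≤ (N : ℝ) ^ (1 + β) ∧ 2 * (N : ℝ) ^ β ≤ 1 := by
  have h1 : ∀ᶠ N : ℕ in atTop, 2 ≤ (N : ℝ) ^ (1 + β) :=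
    ((tendsto_rpow_atTop (by linarith)).comp tendsto_natCast_atTop_atTop).eventually_ge_atTop _
  have h2 : Tendsto (fun N : ℕ => (N : ℝ) ^ β) atTop (nhds 0) := by
    have := (tendsto_rpow_neg_atTop (show 0 < -β by linarith)).comp tendsto_natCast_atTop_atTop
    rw [neg_neg] at this
    exact this
  filter_upwards [eventually_ge_atTop 32, h1, h2.eventually_le_const (show (0 : ℝ) < 1 / 2 by
    norm_num)] with N hN hN1 hN2
  exact ⟨hN, hN1, by linarith⟩

/-- Refinement of `progressionDensity` followed by division by `N`. The point is that `C` does not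
depend on `N`, while the mass is still at least `1 / (2N)` and the transform is large on a set of
measure about `N ^ (1 + α - β)`. -/
theorem eventually_exists_component {α β : ℝ} (hα : 0 < α) (hβ : -1 < β) (hβ0 : β < 0) :
    ∃ C : ℝ, 0 < C ∧ ∀ᶠ N : ℕ in atTop, ∃ (ν : Measure ℝ) (S Ξ : Set ℝ), IsFiniteMeasure ν ∧
      IsClosed S ∧ ν Sᶜ = 0 ∧ S ⊆ Set.Icc 0 (2 * (N : ℝ) ^ β) ∧ S ⊆ alphaWellApproximable α ∧
      1 / (2 * N) ≤ ν.real Set.univ ∧ ν.real Set.univ ≤ 1 ∧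
      (∀ ξ, ‖measureFourier ν ξ‖ ≤ C * decayWeight (2 + α) ξ) ∧
      (∀ x a b y : ℝ, x < a → a ≤ b → b < y → y - x ≤ 1 →
        ν (Set.Icc a b) ≤ ENNReal.ofReal (C * (y - x) ^ ((2 + β) / (2 + α)))) ∧
      MeasurableSet Ξ ∧ ENNReal.ofReal ((N : ℝ) ^ (1 + α - β) / 512) ≤ volume Ξ ∧
      ∀ ξ ∈ Ξ, ν.real Set.univ / 2 ≤ ‖measureFourier ν ξ‖ := by
  set τ := 2 + α with hτdef
  have hτ : 2 ≤ τ := by linarith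
  have hτ0 : 0 < τ := by linarith
  set s := (2 + β) / τ with hs
  have hs0 : 0 < s := div_pos (by linarith) hτ0
  have hs2 : s < 2 / τ := div_lt_div_of_pos_right (by linarith) hτ0
  obtain ⟨C₁, hC₁, h1⟩ := exists_densityFourier_progressionDensity_le hτ
  obtain ⟨C₂, hC₂, h2⟩ := exists_integral_progressionDensity_le hτ hβ hβ0
  refine ⟨C₁ + C₂ + 1, by positivity, ?_⟩
  filter_upwards [eventually_progression_parameters hβ hβ0] with N ⟨hN32, hN1β, hNβ⟩
  have hN : 0 < N := by omega
  have hN' : (0 : ℝ) < N := by exact_mod_cast hN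
  have hN32' : (32 : ℝ) ≤ N := by exact_mod_cast hN32
  -- The conditions on `N` give `N ^ (1 + β) ≤ 2 K` after rounding, and `K + 1 ≤ 2 N ^ (1 + β) ≤ N`,
  -- which keeps the progression inside `(0, 1)`.
  set K := ⌊(N : ℝ) ^ (1 + β)⌋₊ with hKdef
  have hKle : (K : ℝ) ≤ (N : ℝ) ^ (1 + β) := Nat.floor_le (by positivity)
  have hKlt : (N : ℝ) ^ (1 + β) < K + 1 := Nat.lt_floor_add_one _
  have hK1 : (1 : ℝ) < K := by linarith
  have hK : 0 < K := by
    have : (0 : ℝ) < K := by linarith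
    exact_mod_cast this
  have hNN : (N : ℝ) ^ (1 + β) = N * (N : ℝ) ^ β := by rw [Real.rpow_add hN', Real.rpow_one]
  have hK2 : (K : ℝ) + 1 ≤ N * (2 * (N : ℝ) ^ β) := by
    have e : (N : ℝ) * (2 * (N : ℝ) ^ β) = 2 * (N : ℝ) ^ (1 + β) := by rw [hNN]; ring
    linarith
  have hKN : K + 1 ≤ N := by
    have : (K : ℝ) + 1 ≤ N := by nlinarith
    exact_mod_cast this
  -- Perturbation size 1/2 keeps the total mass in `[1/2, 3/2]`.
  obtain ⟨ν, S, hfin, hclosed, hnull, hSsupp, hSnear, hF, hI⟩ := exists_measure_of_smoothDensity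
    (isSmoothDensity_progressionDensity hτ (by omega) hKN) hτ hs0 hs2 (show (0 : ℝ) < 1 / 2 by
      norm_num)
  have hSnhd : S ⊆ progressionNhd τ N K := hSsupp.trans (tsupport_progressionDensity_subset τ hN K)
  have hmeas : ∀ ξ, measureFourier (ENNReal.ofReal (N : ℝ)⁻¹ • ν) ξ =
      (N : ℝ)⁻¹ • measureFourier ν ξ := by
    intro ξ
    unfold measureFourier
    rw [integral_smul_measure, ENNReal.toReal_ofReal (by positivity)]
  have hmass : |ν.real Set.univ - 1| ≤ 1 / 2 := by
    have h0 := hF 0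
    have h00 : measureFourier ν 0 = (ν.real Set.univ : ℂ) := by
      simp [measureFourier]
    rw [integral_progressionDensity_eq_one τ hN hK, decayWeight_zero, h00, mul_one] at h0
    have : ((ν.real Set.univ : ℝ) : ℂ) - 1 = ((ν.real Set.univ - 1 : ℝ) : ℂ) := by push_cast; ring
    rwa [this, Complex.norm_real] at h0
  have hmass' := abs_le.1 hmass
  have hreal : (ENNReal.ofReal (N : ℝ)⁻¹ • ν).real Set.univ = (N : ℝ)⁻¹ * ν.real Set.univ := by
    rw [measureReal_ennreal_smul_apply, ENNReal.toReal_ofReal (by positivity)]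
  have hNinv : (N : ℝ)⁻¹ ≤ 1 / 32 := by
    rw [one_div]; exact inv_anti₀ (by norm_num) hN32'
  have hNinv0 : 0 < (N : ℝ)⁻¹ := by positivity
  -- The frequencies used stay below `N L ≤ N ^ τ / 16`. Rounding costs at most a factor 2 since `N
  -- ≥ 32`, and the constant 512 is `32 * 16`.
  set L := ⌊(N : ℝ) ^ (τ - 1) / 16⌋₊ with hL
  have hNτ : (N : ℝ) ≤ (N : ℝ) ^ (τ - 1) := by
    calc (N : ℝ) = (N : ℝ) ^ (1 : ℝ) := (Real.rpow_one _).symm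
      _ ≤ _ := Real.rpow_le_rpow_of_exponent_le (by linarith) (by linarith)
  have hLle : (L : ℝ) ≤ (N : ℝ) ^ (τ - 1) / 16 := Nat.floor_le (by positivity)
  have hLge : (N : ℝ) ^ (τ - 1) / 32 ≤ L := by
    have := Nat.lt_floor_add_one ((N : ℝ) ^ (τ - 1) / 16)
    linarith
  refine ⟨ENNReal.ofReal (N : ℝ)⁻¹ • ν, S,
    ⋃ n ∈ Finset.range L, Set.Icc (N * n : ℝ) (N * n + N / (16 * K)), ?_, hclosed, ?_, ?_, ?_,
    ?_, ?_, ?_, ?_, ?_, ?_, ?_⟩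
  · exact Measure.smul_finite ν ENNReal.ofReal_ne_top
  · rw [Measure.smul_apply, hnull, smul_zero]
  · refine (hSnhd.trans (progressionNhd_subset hτ (by omega) K)).trans fun x hx => ⟨hx.1.le, ?_⟩
    refine hx.2.le.trans ?_
    rw [div_le_iff₀ hN']
    linarith
  · exact fun x hx => mem_alphaWellApproximable_of_nearRational fun j => hSnear j hx
  · rw [hreal, one_div, mul_inv, mul_comm]
    exact mul_le_mul_of_nonneg_left (by linarith) hNinv0.le
  · rw [hreal]
    nlinarith
  · intro ξ
    rw [hmeas, norm_smul, Real.norm_of_nonneg hNinv0.le, inv_mul_le_iff₀ hN']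
    have e1 := norm_le_norm_add_norm_sub (densityFourier (progressionDensity τ N K) volume ξ)
      (measureFourier ν ξ)
    rw [norm_sub_rev] at e1
    have hw := decayWeight_pos τ ξ
    calc _ ≤ C₁ * N * decayWeight τ ξ + 1 / 2 * decayWeight τ ξ :=
          e1.trans (add_le_add (h1 N K hN hK ξ) (hF ξ))
      _ ≤ C₁ * N * decayWeight τ ξ + (N * 1) * decayWeight τ ξ + N * C₂ * decayWeight τ ξ := by
          have : 0 < N * C₂ * decayWeight τ ξ := by positivity
          nlinarith
      _ = _ := by ring
  · intro x a b y hxa hab hby hxy1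
    rw [Measure.smul_apply, smul_eq_mul]
    calc _ ≤ ENNReal.ofReal (N : ℝ)⁻¹ * ENNReal.ofReal
          ((∫ t in x..y, progressionDensity τ N K t) + 1 / 2 * (y - x) ^ s) :=
          mul_le_mul_right (hI x a b y hxa hab hby hxy1) _
      _ = ENNReal.ofReal ((N : ℝ)⁻¹ *
          ((∫ t in x..y, progressionDensity τ N K t) + 1 / 2 * (y - x) ^ s)) :=
          (ENNReal.ofReal_mul hNinv0.le).symm
      _ ≤ _ := by
          refine ENNReal.ofReal_le_ofReal ?_
          rw [inv_mul_le_iff₀ hN']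
          have hp : 0 ≤ (y - x) ^ s := Real.rpow_nonneg (by linarith) _
          have := h2 N K (by omega) (by linarith) x y (by linarith) hxy1
          calc _ ≤ C₂ * N * (y - x) ^ s + N * 1 * (y - x) ^ s := by
                refine add_le_add this (mul_le_mul_of_nonneg_right (by linarith) hp)
            _ ≤ C₂ * N * (y - x) ^ s + N * 1 * (y - x) ^ s + N * C₁ * (y - x) ^ s :=
                le_add_of_nonneg_right (by positivity)
            _ = _ := by ring
  · exact Finset.measurableSet_biUnion _ fun _ _ => measurableSet_Icc
  · rw [volume_almost_multiples hN hK]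
    refine ENNReal.ofReal_le_ofReal ?_
    have e1 : (N : ℝ) ^ (1 + α - β) * (N : ℝ) ^ (1 + β) = (N : ℝ) ^ (τ - 1) * N := by
      rw [← Real.rpow_add hN', ← Real.rpow_add_one hN'.ne']
      congr 1
      rw [hτdef]
      ring
    have hp : 0 < (N : ℝ) ^ (1 + α - β) := by positivity
    calc (N : ℝ) ^ (1 + α - β) / 512 = (N : ℝ) ^ (1 + α - β) * (N : ℝ) ^ (1 + β) /
          (512 * (N : ℝ) ^ (1 + β)) := by field_simp
      _ ≤ (N : ℝ) ^ (1 + α - β) * (N : ℝ) ^ (1 + β) / (512 * K) :=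
          div_le_div_of_nonneg_left (by positivity) (by positivity)
            (mul_le_mul_of_nonneg_left hKle (by norm_num))
      _ = (N : ℝ) ^ (τ - 1) / 32 * (N / (16 * K)) := by rw [e1]; field_simp; norm_num
      _ ≤ L * (N / (16 * K)) := mul_le_mul_of_nonneg_right hLge (by positivity)
  · intro ξ hξ
    simp only [Set.mem_iUnion, Finset.mem_range] at hξ
    obtain ⟨n, hn, hξ1, hξ2⟩ := hξ
    rw [hmeas, hreal, norm_smul, Real.norm_of_nonneg hNinv0.le, mul_div_assoc]
    refine mul_le_mul_of_nonneg_left ?_ hNinv0.le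
    refine half_mass_le_norm_measureFourier (τ := τ) hN hK ?_ hξ1 hξ2 ?_
    · filter_upwards [measure_eq_zero_iff_ae_notMem.1 hnull] with x hx
      exact hSnhd (not_not.1 hx)
    · have h3 : (N : ℝ) / (16 * K) ≤ N := by
        rw [div_le_iff₀ (by positivity)]
        nlinarith
      have h4 : (n : ℝ) + 1 ≤ L := by exact_mod_cast hn
      have h5 : (N : ℝ) ^ τ = N * (N : ℝ) ^ (τ - 1) := by
        rw [mul_comm, ← Real.rpow_add_one hN'.ne']; simp
      rw [h5]
      nlinarith

/-! ### Norm estimates -/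

/-- For values at most 1, `f ^ q ≤ f`. At `q = ⊤` the convention `1 / 0 = 0` makes the right side 1,
which is the correct bound. -/
theorem eLpNorm_le_lintegral_rpow {μ : Measure ℝ} {f : ℝ → ℝ} (hf : ∀ᵐ x ∂μ, ‖f x‖ₑ ≤ 1)
    {q : ENNReal} (hq : 1 ≤ q) : eLpNorm f q μ ≤ (∫⁻ x, ‖f x‖ₑ ∂μ) ^ (1 / q.toReal) := by
  rcases eq_or_ne q ⊤ with rfl | hq'
  · simp only [ENNReal.toReal_top, div_zero, ENNReal.rpow_zero, eLpNorm_exponent_top]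
    exact essSup_le_of_ae_le _ hf
  · have hQ : 1 ≤ q.toReal := by
      rw [← ENNReal.toReal_one]
      exact ENNReal.toReal_mono hq' hq
    rw [eLpNorm_eq_lintegral_rpow_enorm_toReal (by positivity) hq']
    refine ENNReal.rpow_le_rpow (lintegral_mono_ae ?_) (by positivity)
    filter_upwards [hf] with x hx
    calc ‖f x‖ₑ ^ q.toReal ≤ ‖f x‖ₑ ^ (1 : ℝ) := ENNReal.rpow_le_rpow_of_exponent_ge hx hQ
      _ = _ := ENNReal.rpow_one _

theorem le_eLpNorm_of_forall_mem {f : ℝ → ℂ} {c : ℝ} (hc : 0 ≤ c) {Ξ : Set ℝ}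
    (hΞ : MeasurableSet Ξ) (h : ∀ ξ ∈ Ξ, c ≤ ‖f ξ‖) {p : ENNReal} (hp : p ≠ 0) (hp' : p ≠ ⊤) :
    ENNReal.ofReal c * volume Ξ ^ (1 / p.toReal) ≤ eLpNorm f p volume := by
  have h1 : eLpNorm (Ξ.indicator fun _ => c) p volume ≤ eLpNorm f p volume := by
    refine eLpNorm_mono fun ξ => ?_
    by_cases hξ : ξ ∈ Ξ
    · rw [Set.indicator_of_mem hξ, Real.norm_of_nonneg hc]
      exact h ξ hξ
    · rw [Set.indicator_of_notMem hξ, norm_zero]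
      exact norm_nonneg _
  rw [eLpNorm_indicator_const hΞ hp hp', Real.enorm_of_nonneg hc] at h1
  exact h1

/-- The reciprocal of the conjugate exponent is `1 - 1 / q.toReal`, also at `q = ⊤`, where `q.toReal
= 0` yields 1. Working with reciprocals turns both endpoint cases into one real inequality. -/
theorem toReal_mul_one_sub_lt_of_lt_conjExponent {p q : ENNReal} {γ : ℝ} (hγ : 0 < γ)
    (hq : 1 ≤ q) (hpq : p < ENNReal.conjExponent q * ENNReal.ofReal γ) :
    p ≠ ⊤ ∧ 0 ≤ 1 - 1 / q.toReal ∧ 1 - 1 / q.toReal ≤ 1 ∧ p.toReal * (1 - 1 / q.toReal) < γ := by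
  have hp : p ≠ ⊤ := hpq.ne_top
  have hconj := ENNReal.HolderConjugate.conjExponent hq
  set c := ENNReal.conjExponent q with hc
  have hsum : q⁻¹ + c⁻¹ = 1 := hconj.inv_add_inv_eq_one
  have hq1 : q⁻¹ ≤ 1 := hsum ▸ le_self_add
  have hc1 : c⁻¹ ≤ 1 := hsum ▸ le_add_self
  have hqt : q⁻¹ ≠ ⊤ := ne_top_of_le_ne_top ENNReal.one_ne_top hq1
  have hct : c⁻¹ ≠ ⊤ := ne_top_of_le_ne_top ENNReal.one_ne_top hc1
  have hreal : (c⁻¹).toReal = 1 - 1 / q.toReal := by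
    have := congrArg ENNReal.toReal hsum
    rw [ENNReal.toReal_add hqt hct, ENNReal.toReal_inv, ENNReal.toReal_one] at this
    rw [one_div]
    linarith
  refine ⟨hp, hreal ▸ ENNReal.toReal_nonneg, ?_, ?_⟩
  · have : 0 ≤ 1 / q.toReal := by positivity
    linarith
  · have hlt : p * c⁻¹ < ENNReal.ofReal γ := by
      rcases eq_or_ne c ⊤ with h | h
      · simp [h, hγ]
      · have hc0 : c ≠ 0 := ENNReal.inv_ne_top.1 hct
        rw [← div_eq_mul_inv, ENNReal.div_lt_iff (Or.inl hc0) (Or.inl h), mul_comm]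
        exact hpq
    have := (ENNReal.toReal_lt_toReal (ENNReal.mul_ne_top hp hct) ENNReal.ofReal_ne_top).2 hlt
    rwa [ENNReal.toReal_mul, hreal, ENNReal.toReal_ofReal hγ.le] at this

/-- The product is at least `2 ^ (k (θ k - 1))`: the choice `2 ^ (k ^ 2)` beats the weight `2 ^
(-k)` for every `θ > 0` at once. -/
theorem tendsto_two_pow_mul_rpow_atTop {N : ℕ → ℕ} (hN : ∀ k, 2 ^ (k ^ 2) ≤ N k) {C θ : ℝ}
    (hC : 0 < C) (hθ : 0 < θ) :
    Tendsto (fun k => C * (((1 : ℝ) / 2) ^ k * (N k : ℝ) ^ θ)) atTop atTop := by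
  refine Tendsto.const_mul_atTop hC ?_
  have h1 : Tendsto (fun k : ℕ => (k : ℝ) * (θ * k - 1)) atTop atTop := by
    refine tendsto_natCast_atTop_atTop.atTop_mul_atTop₀ ?_
    exact tendsto_atTop_add_const_right _ _ (tendsto_natCast_atTop_atTop.const_mul_atTop hθ)
  have h2 : Tendsto (fun x : ℝ => (2 : ℝ) ^ x) atTop atTop :=
    tendsto_rpow_atTop_of_base_gt_one 2 one_lt_two
  refine tendsto_atTop_mono (fun k => ?_) (h2.comp h1)
  have e1 : ((2 : ℝ) ^ ((k : ℝ) ^ 2)) ≤ N k := by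
    rw [← Nat.cast_pow, Real.rpow_natCast]
    exact_mod_cast hN k
  have e2 := Real.rpow_le_rpow (by positivity) e1 hθ.le
  rw [← Real.rpow_mul (by norm_num)] at e2
  calc (2 : ℝ) ^ ((k : ℝ) * (θ * k - 1)) = (1 / 2) ^ k * (2 : ℝ) ^ ((k : ℝ) ^ 2 * θ) := by
        rw [one_div, inv_pow, ← Real.rpow_natCast, ← Real.rpow_neg (by norm_num),
          ← Real.rpow_add (by norm_num)]
        congr 1
        ring
    _ ≤ _ := mul_le_mul_of_nonneg_left e2 (by positivity)

/-! ### From compact intervals to order-connected sets -/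

/-- A set of volume at least 1 is covered by total mass 1. A shorter one lies between its infimum
and supremum, and the enlarged endpoints are let tend to these. -/
theorem measure_ordConnected_le {μ : Measure ℝ} [IsProbabilityMeasure μ] {s C : ℝ} (hs : 0 < s)
    (h : ∀ x a b y : ℝ, x < a → a ≤ b → b < y → y - x ≤ 1 →
      μ (Set.Icc a b) ≤ ENNReal.ofReal (C * (y - x) ^ s)) {ε : ℝ} (hε : 0 < ε) (hεs : ε < s) :
    ∃ C' : NNReal, ∀ I : Set ℝ, I.OrdConnected → μ I ≤ C' * volume I ^ (s - ε) := by
  refine ⟨Real.toNNReal (max 1 C), fun I hI => ?_⟩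
  change _ ≤ ENNReal.ofReal (max 1 C) * _
  have hone : 1 ≤ ENNReal.ofReal (max 1 C) := by
    rw [ENNReal.one_le_ofReal]; exact le_max_left _ _
  rcases le_or_gt 1 (volume I) with hv | hv
  · calc μ I ≤ 1 * 1 := by rw [one_mul]; exact prob_le_one
      _ ≤ _ := mul_le_mul' hone (ENNReal.one_le_rpow hv (by linarith))
  rcases I.eq_empty_or_nonempty with rfl | hne
  · simp
  set v := (volume I).toReal with hvdef
  have hvtop : volume I ≠ ⊤ := (hv.trans ENNReal.one_lt_top).ne
  have hv0 : 0 ≤ v := ENNReal.toReal_nonneg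
  have hv1 : v < 1 := by
    rw [hvdef, ← ENNReal.toReal_one]
    exact (ENNReal.toReal_lt_toReal hvtop ENNReal.one_ne_top).2 hv
  have hdiam : ∀ x ∈ I, ∀ y ∈ I, y - x ≤ v := by
    intro x hx y hy
    have := measure_mono (μ := volume) (hI.out hx hy)
    rw [Real.volume_Icc] at this
    exact (ENNReal.ofReal_le_iff_le_toReal hvtop).1 this
  obtain ⟨x₀, hx₀⟩ := hne
  have hbelow : BddBelow I := ⟨x₀ - v, fun x hx => by linarith [hdiam x hx x₀ hx₀]⟩
  have habove : BddAbove I := ⟨x₀ + v, fun x hx => by linarith [hdiam x₀ hx₀ x hx]⟩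
  set a := sInf I with ha
  set b := sSup I with hb
  have hsub : I ⊆ Set.Icc a b := fun x hx => ⟨csInf_le hbelow hx, le_csSup habove hx⟩
  have hab : a ≤ b := (hsub hx₀).1.trans (hsub hx₀).2
  have hbav : b - a ≤ v := by
    have h1 : ∀ x ∈ I, b ≤ x + v := fun x hx =>
      csSup_le ⟨x₀, hx₀⟩ fun y hy => by linarith [hdiam x hx y hy]
    have h2 : b - v ≤ a := le_csInf ⟨x₀, hx₀⟩ fun x hx => by linarith [h1 x hx]
    linarith
  have hlim : Tendsto (fun t : ℝ => ENNReal.ofReal (C * (b - a + 2 * t) ^ s))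
      (nhdsWithin 0 (Set.Ioi 0)) (nhds (ENNReal.ofReal (C * (b - a) ^ s))) := by
    have hcont : Continuous fun t : ℝ => ENNReal.ofReal (C * (b - a + 2 * t) ^ s) :=
      ENNReal.continuous_ofReal.comp (continuous_const.mul
        ((Real.continuous_rpow_const hs.le).comp (by fun_prop)))
    have := hcont.tendsto 0
    simp only [mul_zero, add_zero] at this
    exact this.mono_left nhdsWithin_le_nhds
  have hle : μ (Set.Icc a b) ≤ ENNReal.ofReal (C * (b - a) ^ s) := by
    refine ge_of_tendsto hlim ?_
    have hpos : (0 : ℝ) < (1 - (b - a)) / 2 := by linarith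
    filter_upwards [Ioo_mem_nhdsGT hpos] with t ht
    have := h (a - t) a b (b + t) (by linarith [ht.1]) hab (by linarith [ht.1])
      (by linarith [ht.2])
    rwa [show b + t - (a - t) = b - a + 2 * t by ring] at this
  calc μ I ≤ ENNReal.ofReal (C * (b - a) ^ s) := (measure_mono hsub).trans hle
    _ ≤ ENNReal.ofReal (max 1 C * v ^ s) :=
        ENNReal.ofReal_le_ofReal (mul_le_mul (le_max_right _ _)
          (Real.rpow_le_rpow (by linarith) hbav hs.le) (Real.rpow_nonneg (by linarith) _)
          (by positivity))
    _ = ENNReal.ofReal (max 1 C) * volume I ^ s := by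
        rw [ENNReal.ofReal_mul (by positivity), ← ENNReal.ofReal_rpow_of_nonneg hv0 hs.le, hvdef,
          ENNReal.ofReal_toReal hvtop]
    _ ≤ _ := mul_le_mul_right (ENNReal.rpow_le_rpow_of_exponent_ge hv.le (by linarith)) _

/-! ### Weighted sums of the building blocks -/

/-- The weights `2 ^ (-k)`, normalized so that `∑ k, w k * m k = 1`. -/
noncomputable def normalizedWeight (m : ℕ → ℝ) (k : ℕ) : ℝ :=
  (1 / 2) ^ k / ∑' j, (1 / 2) ^ j * m j

theorem summable_half_pow_mul {m : ℕ → ℝ} (hm : ∀ k, 0 < m k) (hm1 : ∀ k, m k ≤ 1)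
    : Summable fun k => (1 / 2 : ℝ) ^ k * m k :=
  Summable.of_nonneg_of_le (fun k => mul_nonneg (by positivity) (hm k).le)
    (fun k => mul_le_of_le_one_right (by positivity) (hm1 k)) summable_geometric_two

theorem tsum_half_pow_mul_pos {m : ℕ → ℝ} (hm : ∀ k, 0 < m k) (hm1 : ∀ k, m k ≤ 1)
    : 0 < ∑' k, (1 / 2 : ℝ) ^ k * m k :=
  (summable_half_pow_mul hm hm1).tsum_pos (fun k => mul_nonneg (by positivity) (hm k).le) 0
    (by simpa using hm 0)

theorem normalizedWeight_pos {m : ℕ → ℝ} (hm : ∀ k, 0 < m k) (hm1 : ∀ k, m k ≤ 1)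
    (k : ℕ) : 0 < normalizedWeight m k :=
  div_pos (by positivity) (tsum_half_pow_mul_pos hm hm1)

theorem hasSum_normalizedWeight_mul {m : ℕ → ℝ} (hm : ∀ k, 0 < m k) (hm1 : ∀ k, m k ≤ 1)
    : HasSum (fun k => normalizedWeight m k * m k) 1 := by
  have h := (summable_half_pow_mul hm hm1).hasSum.div_const (∑' k, (1 / 2 : ℝ) ^ k * m k)
  rw [div_self (tsum_half_pow_mul_pos hm hm1).ne'] at h
  convert! h using 1
  ext k
  rw [normalizedWeight, div_mul_eq_mul_div]

theorem summable_normalizedWeight (m : ℕ → ℝ) : Summable (normalizedWeight m) :=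
  summable_geometric_two.div_const _

/-- If closed sets `S k ⊆ [0, r k]` carry the measures `κ k` and `r k → 0`, then the support of
`∑ κ k` adds at most the point `0` to the union of the sets `S k`. -/
theorem support_sum_subset {κ : ℕ → Measure ℝ} {S : ℕ → Set ℝ} {r : ℕ → ℝ}
    (hS : ∀ k, IsClosed (S k)) (hκ : ∀ k, κ k (S k)ᶜ = 0) (hSr : ∀ k, S k ⊆ Set.Icc 0 (r k))
    (hr : Tendsto r atTop (nhds 0)) : (Measure.sum κ).support ⊆ {0} ∪ ⋃ k, S k := by
  intro x hx
  by_contra hne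
  simp only [Set.mem_union, Set.mem_singleton_iff, Set.mem_iUnion, not_or, not_exists] at hne
  obtain ⟨hx0, hxS⟩ := hne
  have hpos : 0 < |x| / 2 := by positivity
  obtain ⟨n₀, hn₀⟩ := eventually_atTop.1 (hr.eventually_lt_const hpos)
  -- Away from `0` only finitely many of the sets `S k` matter, and a finite union of closed sets is
  -- closed.
  set U : Set ℝ := {y | |x| / 2 < |y|} ∩ ⋂ k ∈ Finset.range n₀, (S k)ᶜ
  have hU : IsOpen U := (isOpen_lt continuous_const continuous_abs).inter
    (isOpen_biInter_finset fun k _ => (hS k).isOpen_compl)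
  have hxU : x ∈ U := by
    refine ⟨?_, ?_⟩
    · change |x| / 2 < |x|
      linarith
    · simp only [Set.mem_iInter]
      exact fun k _ => hxS k
  have h0 : Measure.sum κ U = 0 := by
    rw [Measure.sum_apply _ hU.measurableSet, ENNReal.tsum_eq_zero]
    intro k
    refine measure_mono_null (fun y hy => ?_) (hκ k)
    by_cases hk : k < n₀
    · have := hy.2
      simp only [Set.mem_iInter] at this
      exact this k (Finset.mem_range.2 hk)
    · intro hyS
      have h1 := hn₀ k (not_lt.1 hk)
      have h2 := hSr k hyS
      have h3 : |x| / 2 < |y| := hy.1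
      rw [abs_of_nonneg h2.1] at h3
      linarith [h2.2]
  exact absurd ((Measure.mem_support_iff_forall x).1 hx U (hU.mem_nhds hxU)) (by simp [h0])

/-! ### Densities of the building blocks -/

section rnDeriv

variable {κ μ : Measure ℝ} [IsFiniteMeasure κ] [IsFiniteMeasure μ]

theorem enorm_toReal_rnDeriv (κ μ : Measure ℝ) [IsFiniteMeasure κ] [IsFiniteMeasure μ] :
    (fun x => ‖(κ.rnDeriv μ x).toReal‖ₑ) =ᵐ[μ] κ.rnDeriv μ := by
  filter_upwards [Measure.rnDeriv_lt_top κ μ] with x hx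
  rw [Real.enorm_of_nonneg ENNReal.toReal_nonneg, ENNReal.ofReal_toReal hx.ne]

theorem enorm_toReal_rnDeriv_le_one (h : κ ≤ μ) :
    ∀ᵐ x ∂μ, ‖(κ.rnDeriv μ x).toReal‖ₑ ≤ 1 := by
  filter_upwards [enorm_toReal_rnDeriv κ μ, Measure.rnDeriv_le_one_of_le h] with x h1 h2
  rw [h1]
  exact h2

theorem memLp_top_toReal_rnDeriv (h : κ ≤ μ) :
    MemLp (fun x => (κ.rnDeriv μ x).toReal) ⊤ μ := by
  refine memLp_top_of_bound
    (Measure.measurable_rnDeriv κ μ).ennreal_toReal.aestronglyMeasurable 1 ?_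
  filter_upwards [enorm_toReal_rnDeriv_le_one h] with x hx
  rwa [← ofReal_norm, ENNReal.ofReal_le_one] at hx

theorem not_toReal_rnDeriv_ae_eq_zero (h : κ ≤ μ) (h0 : 0 < κ.real Set.univ) :
    ¬ (fun x => (κ.rnDeriv μ x).toReal) =ᵐ[μ] 0 := by
  intro hz
  have h1 := Measure.integral_toReal_rnDeriv (Measure.absolutelyContinuous_of_le h)
  rw [integral_congr_ae hz] at h1
  simp only [Pi.zero_apply, integral_zero] at h1
  linarith

/-- The density is at most 1 because `κ ≤ μ`, so its `L^q` norm is governed by its integral, the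
mass of `κ`. Overlap with the other blocks does no harm. -/
theorem eLpNorm_toReal_rnDeriv_le (h : κ ≤ μ) {q : ENNReal} (hq : 1 ≤ q) :
    eLpNorm (fun x => (κ.rnDeriv μ x).toReal) q μ ≤ κ Set.univ ^ (1 / q.toReal) := by
  refine (eLpNorm_le_lintegral_rpow (enorm_toReal_rnDeriv_le_one h) hq).trans ?_
  rw [lintegral_congr_ae (enorm_toReal_rnDeriv κ μ),
    Measure.lintegral_rnDeriv (Measure.absolutelyContinuous_of_le h)]

theorem densityFourier_toReal_rnDeriv (h : κ ≤ μ) (ξ : ℝ) :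
    densityFourier (fun x => (κ.rnDeriv μ x).toReal) μ ξ = measureFourier κ ξ := by
  unfold densityFourier measureFourier
  rw [← integral_rnDeriv_smul (Measure.absolutelyContinuous_of_le h)]
  congr 1
  ext x
  rw [Complex.real_smul, mul_comm]

/-- A lower bound for the restriction quotient of the density of `κ` with respect to `μ`. -/
theorem ofReal_le_quotient_of_large_fourier (h : κ ≤ μ) (h0 : 0 < κ.real Set.univ) {V : ℝ}
    (hV : 0 < V) {Ξ : Set ℝ} (hΞ : MeasurableSet Ξ) (hΞV : ENNReal.ofReal V ≤ volume Ξ)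
    (hF : ∀ ξ ∈ Ξ, κ.real Set.univ / 2 ≤ ‖measureFourier κ ξ‖) {p q : ENNReal} (hp : p ≠ 0)
    (hp' : p ≠ ⊤) (hq : 1 ≤ q) :
    ENNReal.ofReal (1 / 2 * (κ.real Set.univ ^ (1 - 1 / q.toReal) * V ^ (1 / p.toReal))) ≤
      eLpNorm (densityFourier (fun x => (κ.rnDeriv μ x).toReal) μ) p volume /
        eLpNorm (fun x => (κ.rnDeriv μ x).toReal) q μ := by
  set M := κ.real Set.univ with hM
  have hκ : κ Set.univ = ENNReal.ofReal M := by rw [hM, ofReal_measureReal]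
  have hnum : ENNReal.ofReal (M / 2) * ENNReal.ofReal (V ^ (1 / p.toReal)) ≤
      eLpNorm (densityFourier (fun x => (κ.rnDeriv μ x).toReal) μ) p volume := by
    refine le_trans ?_ (le_eLpNorm_of_forall_mem (c := M / 2) (by positivity) hΞ
      (fun ξ hξ => by rw [densityFourier_toReal_rnDeriv h]; exact hF ξ hξ) hp hp')
    refine mul_le_mul_right ?_ _
    rw [← ENNReal.ofReal_rpow_of_nonneg hV.le (by positivity)]
    exact ENNReal.rpow_le_rpow hΞV (by positivity)
  have hden : eLpNorm (fun x => (κ.rnDeriv μ x).toReal) q μ ≤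
      ENNReal.ofReal (M ^ (1 / q.toReal)) := by
    refine (eLpNorm_toReal_rnDeriv_le h hq).trans (le_of_eq ?_)
    rw [hκ, ENNReal.ofReal_rpow_of_nonneg h0.le (by positivity)]
  calc _ = ENNReal.ofReal (M / 2) * ENNReal.ofReal (V ^ (1 / p.toReal)) /
        ENNReal.ofReal (M ^ (1 / q.toReal)) := by
        rw [← ENNReal.ofReal_mul (by positivity), ← ENNReal.ofReal_div_of_pos (by positivity),
          Real.rpow_sub h0, Real.rpow_one]
        congr 1
        ring
    _ ≤ _ := ENNReal.div_le_div hnum hden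

end rnDeriv

theorem theorem1p6 (α β : ℝ) (hα : 0 < α) (hβ : -1 < β) (hβ' : β < 0) :
    ∃ μ : Measure ℝ, IsProbabilityMeasure μ ∧
      μ.support ⊆ Set.Icc (-1 / 2 : ℝ) (1 / 2) ∩ alphaWellApproximable α ∧
      (∀ ε : ℝ, 0 < ε → ε < (2 + β) / (2 + α) →
        ∃ C : NNReal, ∀ I : Set ℝ, I.OrdConnected →
          μ I ≤ C * volume I ^ ((2 + β) / (2 + α) - ε)) ∧
      (∀ ε : ℝ, 0 < ε →
        ∃ C : ℝ, ∀ ξ : ℝ, ‖measureFourier μ ξ‖ ≤ C * (1 + |ξ|) ^ (-(1 / (2 + α)) + ε)) ∧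
      ∃ f : ℕ → ℝ → ℝ,
        (∀ k, Measurable (f k) ∧ (∀ x, 0 ≤ f k x) ∧ MemLp (f k) ⊤ μ ∧ ¬ f k =ᵐ[μ] 0) ∧
        ∀ p q : ENNReal, 0 < p → 1 ≤ q →
          p < ENNReal.conjExponent q * ENNReal.ofReal (1 + α - β) →
          ⨆ k : ℕ, eLpNorm (densityFourier (f k) μ) p volume / eLpNorm (f k) q μ = ⊤ := by
  obtain ⟨C, hC, hev⟩ := eventually_exists_component hα hβ hβ'
  have hdecay : Tendsto (fun N : ℕ => 2 * (N : ℝ) ^ β) atTop (nhds 0) := by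
    have := (tendsto_rpow_neg_atTop (show 0 < -β by linarith)).comp tendsto_natCast_atTop_atTop
    rw [neg_neg] at this
    simpa using this.const_mul 2
  -- The growth `N k ≥ 2 ^ (k ^ 2)` serves the last claim; `2 (N k) ^ β ≤ 1/2` places each block in
  -- `[0, 1/2]`.
  have hchoice := fun k : ℕ => ((eventually_ge_atTop (2 ^ (k ^ 2))).and
    ((hdecay.eventually_le_const (show (0 : ℝ) < 1 / 2 by norm_num)).and hev)).exists
  choose N hN hNβ ν S Ξ hfin hcl hnull hS hSE hm hm1 hF hI hΞ hΞv hΞF using hchoice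
  have hN1 : ∀ k, (1 : ℝ) ≤ N k := fun k => by
    exact_mod_cast (Nat.one_le_two_pow).trans (hN k)
  have hNpos : ∀ k, (0 : ℝ) < N k := fun k => zero_lt_one.trans_le (hN1 k)
  have hNlim : Tendsto N atTop atTop := by
    refine tendsto_atTop_mono (fun k => ?_) tendsto_id
    exact (Nat.le_self_pow two_ne_zero k).trans (Nat.lt_two_pow_self.le.trans (hN k))
  set m : ℕ → ℝ := fun k => (ν k).real Set.univ with hmdef
  have hm0 : ∀ k, 0 < m k := fun k => lt_of_lt_of_le (by have := hNpos k; positivity) (hm k)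
  set w := normalizedWeight m with hw
  have hw0 : ∀ k, 0 < w k := normalizedWeight_pos hm0 hm1
  have hwsum : Summable w := summable_normalizedWeight m
  set κ : ℕ → Measure ℝ := fun k => ENNReal.ofReal (w k) • ν k with hκ
  have hκfin : ∀ k, IsFiniteMeasure (κ k) := fun k =>
    Measure.smul_finite (ν k) ENNReal.ofReal_ne_top
  have hκreal : ∀ k, (κ k).real Set.univ = w k * m k := by
    intro k
    rw [hκ, measureReal_ennreal_smul_apply, ENNReal.toReal_ofReal (hw0 k).le]
  have hκmass : ∀ k, κ k Set.univ = ENNReal.ofReal (w k * m k) := by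
    intro k
    rw [← hκreal k, ofReal_measureReal]
  have hκF : ∀ k ξ, measureFourier (κ k) ξ = w k • measureFourier (ν k) ξ := by
    intro k ξ
    unfold measureFourier
    rw [hκ, integral_smul_measure, ENNReal.toReal_ofReal (hw0 k).le]
  have hκnull : ∀ k, κ k (S k)ᶜ = 0 := fun k => by
    rw [hκ, Measure.smul_apply, hnull, smul_zero]
  set μ := Measure.sum κ with hμ
  have hprob : IsProbabilityMeasure μ := by
    constructor
    have h1 := hasSum_normalizedWeight_mul hm0 hm1
    rw [hμ, Measure.sum_apply _ MeasurableSet.univ, tsum_congr hκmass,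
      ← ENNReal.ofReal_tsum_of_nonneg (fun k => (mul_pos (hw0 k) (hm0 k)).le) h1.summable,
      h1.tsum_eq, ENNReal.ofReal_one]
  have hle : ∀ k, κ k ≤ μ := Measure.le_sum κ
  refine ⟨μ, hprob, ?_, ?_, ?_, fun k x => ((κ k).rnDeriv μ x).toReal, ?_, ?_⟩
  · refine (support_sum_subset hcl hκnull hS (hdecay.comp hNlim)).trans ?_
    rintro x (hx | hx)
    · rw [Set.mem_singleton_iff.1 hx]
      exact ⟨by norm_num, zero_mem_alphaWellApproximable α⟩
    · obtain ⟨k, hk⟩ := Set.mem_iUnion.1 hx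
      have := hS k hk
      exact ⟨⟨by linarith [this.1], this.2.trans (hNβ k)⟩, hSE k hk⟩
  · intro ε hε hεs
    refine measure_ordConnected_le (C := (∑' k, w k) * C) (hε.trans hεs) ?_ hε hεs
    intro x a b y hxa hab hby hxy1
    rw [hμ, Measure.sum_apply _ measurableSet_Icc, mul_assoc,
      ENNReal.ofReal_mul (tsum_nonneg fun k => (hw0 k).le),
      ENNReal.ofReal_tsum_of_nonneg (fun k => (hw0 k).le) hwsum, ← ENNReal.tsum_mul_right]
    refine ENNReal.tsum_le_tsum fun k => ?_
    rw [hκ, Measure.smul_apply, smul_eq_mul]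
    exact mul_le_mul_right (hI k x a b y hxa hab hby hxy1) _
  · intro ε hε
    obtain ⟨D, hD⟩ := exists_decayWeight_le (2 + α) hε
    refine ⟨(∑' k, w k) * C * D, fun ξ => ?_⟩
    have hint : Integrable (fun x : ℝ => Complex.exp (-2 * Real.pi * Complex.I * x * ξ)) μ := by
      refine Integrable.of_bound (by fun_prop) 1 ?_
      exact Filter.Eventually.of_forall fun x => (norm_exp_neg_two_pi_mul x ξ).le
    have hsum : measureFourier μ ξ = ∑' k, measureFourier (κ k) ξ := integral_sum_measure hint
    have h1 : ‖measureFourier μ ξ‖ ≤ (∑' k, w k) * (C * decayWeight (2 + α) ξ) := by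
      rw [hsum]
      refine tsum_of_norm_bounded (hwsum.hasSum.mul_right _) fun k => ?_
      rw [hκF, norm_smul, Real.norm_of_nonneg (hw0 k).le]
      exact mul_le_mul_of_nonneg_left (hF k ξ) (hw0 k).le
    calc _ ≤ (∑' k, w k) * (C * decayWeight (2 + α) ξ) := h1
      _ ≤ (∑' k, w k) * (C * (D * (1 + |ξ|) ^ (-(1 / (2 + α)) + ε))) :=
          mul_le_mul_of_nonneg_left (mul_le_mul_of_nonneg_left (hD ξ) hC.le)
            (tsum_nonneg fun k => (hw0 k).le)
      _ = _ := by ring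
  · intro k
    refine ⟨(Measure.measurable_rnDeriv _ _).ennreal_toReal, fun x => ENNReal.toReal_nonneg,
      memLp_top_toReal_rnDeriv (hle k), not_toReal_rnDeriv_ae_eq_zero (hle k) ?_⟩
    rw [hκreal]
    exact mul_pos (hw0 k) (hm0 k)
  · intro p q hp hq hpq
    have hγ : 0 < 1 + α - β := by linarith
    obtain ⟨hp', ht0, ht1, hlt⟩ := toReal_mul_one_sub_lt_of_lt_conjExponent hγ hq hpq
    set t := 1 - 1 / q.toReal with ht
    set P := p.toReal with hP
    have hP0 : 0 < P := ENNReal.toReal_pos hp.ne' hp'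
    -- This is the net power of `N k`: `(1 + α - β) / P` from the set of large frequencies, minus
    -- `t` from the mass, which is of order at least `2 ^ (-k) / N k`.
    set θ := (1 + α - β) / P - t with hθ
    have hθ0 : 0 < θ := by
      rw [hθ, sub_pos, lt_div_iff₀ hP0, mul_comm]
      exact hlt
    set Z := ∑' j, (1 / 2 : ℝ) ^ j * m j with hZ
    have hZ0 : 0 < Z := tsum_half_pow_mul_pos hm0 hm1
    set c := 1 / 2 * ((1 / (2 * Z)) ^ t * (1 / 512 : ℝ) ^ (1 / P)) with hc
    have hc0 : 0 < c := by positivity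
    have hlim := tendsto_two_pow_mul_rpow_atTop hN hc0 hθ0
    have hlower : ∀ k, c * ((1 / 2 : ℝ) ^ k * (N k : ℝ) ^ θ) ≤
        1 / 2 * ((κ k).real Set.univ ^ t * ((N k : ℝ) ^ (1 + α - β) / 512) ^ (1 / P)) := by
      intro k
      have hNk := hNpos k
      have e1 : 1 / (2 * Z) * ((1 / 2 : ℝ) ^ k * (N k : ℝ)⁻¹) ≤ (κ k).real Set.univ := by
        rw [hκreal, hw, normalizedWeight, ← hZ]
        calc _ = (1 / 2 : ℝ) ^ k / Z * (1 / (2 * N k)) := by field_simp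
          _ ≤ _ := mul_le_mul_of_nonneg_left (hm k) (by positivity)
      have e2 := Real.rpow_le_rpow (by positivity) e1 ht0
      rw [Real.mul_rpow (by positivity) (by positivity),
        Real.mul_rpow (by positivity) (by positivity), Real.inv_rpow hNk.le,
        ← Real.rpow_neg hNk.le] at e2
      -- As `t ≤ 1`, the weight may be counted in full, so one growth statement covers every `q`.
      have e3 : (1 / 2 : ℝ) ^ k ≤ ((1 / 2 : ℝ) ^ k) ^ t := by
        conv_lhs => rw [← Real.rpow_one ((1 / 2 : ℝ) ^ k)]
        exact Real.rpow_le_rpow_of_exponent_ge (by positivity)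
          (pow_le_one₀ (by norm_num) (by norm_num)) ht1
      have e4 : ((N k : ℝ) ^ (1 + α - β) / 512) ^ (1 / P) =
          (N k : ℝ) ^ ((1 + α - β) / P) * (1 / 512 : ℝ) ^ (1 / P) := by
        rw [div_eq_mul_one_div, Real.mul_rpow (by positivity) (by norm_num),
          ← Real.rpow_mul hNk.le, mul_one_div]
      have e5 : (N k : ℝ) ^ θ = (N k : ℝ) ^ (-t) * (N k : ℝ) ^ ((1 + α - β) / P) := by
        rw [← Real.rpow_add hNk]
        congr 1
        rw [hθ]
        ring
      rw [e4, e5, hc]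
      calc _ = 1 / 2 * (((1 / (2 * Z)) ^ t * ((1 / 2 : ℝ) ^ k * (N k : ℝ) ^ (-t))) *
            ((N k : ℝ) ^ ((1 + α - β) / P) * (1 / 512 : ℝ) ^ (1 / P))) := by ring
        _ ≤ 1 / 2 * (((1 / (2 * Z)) ^ t * (((1 / 2 : ℝ) ^ k) ^ t * (N k : ℝ) ^ (-t))) *
            ((N k : ℝ) ^ ((1 + α - β) / P) * (1 / 512 : ℝ) ^ (1 / P))) := by gcongr
        _ ≤ _ := by gcongr
    rw [iSup_eq_top]
    intro B hB
    obtain ⟨k, hk⟩ := (hlim.eventually_gt_atTop B.toReal).exists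
    refine ⟨k, ?_⟩
    have hκ0 : 0 < (κ k).real Set.univ := by
      rw [hκreal]
      exact mul_pos (hw0 k) (hm0 k)
    have hNk := hNpos k
    refine lt_of_lt_of_le ?_ (ofReal_le_quotient_of_large_fourier (hle k) hκ0
      (show 0 < (N k : ℝ) ^ (1 + α - β) / 512 by positivity) (hΞ k) (hΞv k) ?_ hp.ne' hp' hq)
    · rw [← ENNReal.ofReal_toReal hB.ne]
      exact (ENNReal.ofReal_lt_ofReal_iff_of_nonneg ENNReal.toReal_nonneg).2
        (hk.trans_le (hlower k))
    · intro ξ hξ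
      rw [hκreal, hκF, norm_smul, Real.norm_of_nonneg (hw0 k).le, mul_div_assoc]
      exact mul_le_mul_of_nonneg_left (hΞF k ξ hξ) (hw0 k).le
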